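/- Gödel's universe is the spacetime with coordinates $(\tau,r,\phi,\zeta)$ ($r\ge 0$, $\phi$ an angle) and metric $-d\tau^2-2\sqrt2\,r^2d\phi\,d\tau+r^2(1-r^2)d\phi^2+(1+r^2)^{-1}dr^2+d\zeta^2$, time-oriented by $\partial_\tau$. A lightlike path is a finite sequence of segments of future-pointing null geodesics, each starting where the previous one ends. A geodesic $\gamma$ has the constants of motion $L_1=-g(\dot\gamma,\partial_\tau)$, $L_2=-g(\dot\gamma,\partial_\phi)$, $L_3=g(\dot\gamma,\partial_\zeta)$ and, if $L_2>0$, the parameters $\kappa=L_1/L_2$, $\lambda=L_3/L_2$. Put $\tau_*=\frac{\pi}{2}(\sqrt2-1)$, $\kappa_1(1)=\frac1{2\sqrt2}$, $\kappa_1(u)=\frac{\sqrt2u-\sqrt{u^2+u}}{u(u-1)}$ for $u>1$, and $\kappa_{\min}(u)=\sqrt2/u$. For a point $P$ with $r(P)^2=u_0\ge1$, $\tau(P)=\tau_0$, let $\mathcal E^{\rm SE}_P$, the south-east portion of the envelope of the planar ($\lambda=0$) future-pointing null geodesics from $P$, be the set of the points with $$r^2=1+\frac{2\sqrt2}{\kappa}-u_0,\qquad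 \tau=\tau_0-\frac\pi2+\sqrt2\arctan\frac{\sqrt2\kappa+1}{\sqrt{u_0(1-u_0)\kappa^2+2\sqrt2u_0\kappa-1}},\qquad \kappa_1(u_0)\le\kappa\le\kappa_{\min}(u_0)$$ (with $\arctan(+\infty)=\pi/2$ at $\kappa=\kappa_1(u_0)$, where the radicand vanishes). An initially outgoing SE-segment is a segment $\gamma:[0,s_*]\to M$ of a future-pointing null geodesic with initial point $P=\gamma(0)$, $u=r(P)^2\ge1$, that has $L_2>0$, $\lambda=0$, $\kappa_1(u)\le\kappa\le\kappa_{\min}(u)$, $\dot r(0)\ge0$ and $\gamma(s_*)\in\mathcal E^{\rm SE}_P$. **Proposition.** Let $A_0$ be any point with $(r,\tau)=(1,\tau_*)$. There are an $m$ and a lightlike path with $2m$ segments from $A_0$ to a point $A_{N-1}$ with $(r,\tau)=(1,-\tau_*)$ such that: 1. the path is optimal: every lightlike path from a point with $(r,\tau)=(1,\tau_*)$ to a point with $(r,\tau)=(1,-\tau_*)$ has at least $2m$ segments; moreover, if $\mathcal O$ is the point of the axis $r=0$ with $\tau=0$ and $\zeta=\zeta(A_0)$, there are a single future-pointing null geodesic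 segment from $\mathcal O$ to $A_0$ and one from $A_{N-1}$ to $\mathcal O$, and every closed lightlike path from $\mathcal O$ to $\mathcal O$ (with at least one segment) has at least $N:=2m+2$ segments; 2. the first $m$ segments are initially outgoing SE-segments, and they lead from $A_0$ to a point with $\tau=0$; no lightlike path from a point with $(r,\tau)=(1,\tau_*)$ to a point with $\tau=0$ has fewer than $m$ segments; 3. the last $m$ segments retrace the first $m$ in reverse order: they too are planar, with the same values of $\kappa$, and segment $2m+1-i$ is obtained from segment $i$ by reversing the parameter and replacing $\tau$ by $-\tau$ (the functions $r$ and $\zeta$ along it being those of segment $i$ reversed). -/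

import Mathlib

namespace Godel

noncomputable section

/-- Events of Gödel's universe in the global coordinates `(τ, x, y, ζ)`, where
`x = r cos φ` and `y = r sin φ`. -/
abbrev Event : Type := Fin 4 → ℝ

/-- The coordinate `τ`. -/
def tau (p : Event) : ℝ := p 0

/-- The coordinate `r`. -/
def radius (p : Event) : ℝ := Real.sqrt (p 1 ^ 2 + p 2 ^ 2)

/-- The coordinate `ζ`. -/
def zeta (p : Event) : ℝ := p 3

/-- The one-form `r² dφ = x dy - y dx` at `p`, applied to `v`. -/
def rSqDphi (p v : Event) : ℝ := p 1 * v 2 - p 2 * v 1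

/-- The one-form `r dr = x dx + y dy` at `p`, applied to `v`. -/
def rDr (p v : Event) : ℝ := p 1 * v 1 + p 2 * v 2

/-- The Gödel metric
`-dτ² - 2√2 r² dφ dτ + r²(1 - r²) dφ² + (1 + r²)⁻¹ dr² + dζ²`
at `p`, as a symmetric bilinear form in `v` and `w`, written in the coordinates `(τ, x, y, ζ)`
in which it is smooth everywhere, the axis `r = 0` included. -/
def metric (p v w : Event) : ℝ :=
  -(v 0 * w 0) - Real.sqrt 2 * (rSqDphi p v * w 0 + v 0 * rSqDphi p w)
    + (v 1 * w 1 + v 2 * w 2) - rSqDphi p v * rSqDphi p w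
    - rDr p v * rDr p w / (1 + (p 1 ^ 2 + p 2 ^ 2)) + v 3 * w 3

/-- The line element in the cylindrical coordinates `(τ, r, φ, ζ)`. The tangent vector with
components `(dτ, dr, dφ, dζ)` has `dx = cos φ dr - r sin φ dφ`, `dy = sin φ dr + r cos φ dφ`. -/
theorem metric_cylindrical (t r φ z dt dr dφ dz : ℝ) :
    metric ![t, r * Real.cos φ, r * Real.sin φ, z]
      ![dt, Real.cos φ * dr - r * Real.sin φ * dφ, Real.sin φ * dr + r * Real.cos φ * dφ, dz]
      ![dt, Real.cos φ * dr - r * Real.sin φ * dφ, Real.sin φ * dr + r * Real.cos φ * dφ, dz]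
    = -dt ^ 2 - 2 * Real.sqrt 2 * r ^ 2 * dφ * dt + r ^ 2 * (1 - r ^ 2) * dφ ^ 2
      + (1 + r ^ 2)⁻¹ * dr ^ 2 + dz ^ 2 := by
  have hc : Real.cos φ ^ 2 = 1 - Real.sin φ ^ 2 := Real.cos_sq' φ
  have h1 : r * Real.cos φ * (Real.sin φ * dr + r * Real.cos φ * dφ)
      - r * Real.sin φ * (Real.cos φ * dr - r * Real.sin φ * dφ) = r ^ 2 * dφ := by
    linear_combination r ^ 2 * dφ * hc
  have h2 : r * Real.cos φ * (Real.cos φ * dr - r * Real.sin φ * dφ)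
      + r * Real.sin φ * (Real.sin φ * dr + r * Real.cos φ * dφ) = r * dr := by
    linear_combination r * dr * hc
  have h3 : (r * Real.cos φ) ^ 2 + (r * Real.sin φ) ^ 2 = r ^ 2 := by
    linear_combination r ^ 2 * hc
  have h4 : (Real.cos φ * dr - r * Real.sin φ * dφ) * (Real.cos φ * dr - r * Real.sin φ * dφ)
      + (Real.sin φ * dr + r * Real.cos φ * dφ) * (Real.sin φ * dr + r * Real.cos φ * dφ)
      = dr ^ 2 + r ^ 2 * dφ ^ 2 := by
    linear_combination (dr ^ 2 + r ^ 2 * dφ ^ 2) * hc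
  have h5 : (1 + r ^ 2) ≠ 0 := by positivity
  simp only [metric, rSqDphi, rDr, Matrix.cons_val]
  rw [h1, h2, h3, h4]
  field_simp
  ring

/-- `(∂_a g)(v, w)` at `p`: the derivative of the metric components in the direction `a`. -/
def metricDeriv (p a v w : Event) : ℝ := fderiv ℝ (fun q => metric q v w) p a

/-- Affinely parametrized (complete) geodesics of the Gödel metric: `g(∇_γ' γ', w) = 0` for all
`w`, where in coordinates
`g(∇_γ' γ', w) = g(γ'', w) + (∂_γ' g)(γ', w) - (1/2) (∂_w g)(γ', γ')`. -/
structure IsGeodesic (γ : ℝ → Event) : Prop where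
  contDiff : ContDiff ℝ 2 γ
  equation : ∀ (s : ℝ) (w : Event),
    metric (γ s) (deriv (deriv γ) s) w + metricDeriv (γ s) (deriv γ s) (deriv γ s) w
      - 1 / 2 * metricDeriv (γ s) w (deriv γ s) (deriv γ s) = 0

/-- The fluid flow vector `∂/∂τ`. -/
def partialTau : Event := ![1, 0, 0, 0]

/-- The vector field `∂/∂φ = -y ∂/∂x + x ∂/∂y`. -/
def partialPhi (p : Event) : Event := ![0, -p 2, p 1, 0]

/-- The vector field `∂/∂ζ`. -/
def partialZeta : Event := ![0, 0, 0, 1]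

/-- Future-pointing null geodesics: the future half of the light cone is the one that contains
`∂/∂τ`. -/
structure IsFutureNullGeodesic (γ : ℝ → Event) : Prop where
  geodesic : IsGeodesic γ
  null : ∀ s, metric (γ s) (deriv γ s) (deriv γ s) = 0
  future : ∀ s, metric (γ s) partialTau (deriv γ s) < 0

/-- `γ` restricted to `[0, ℓ]` is a segment of a future-pointing null geodesic from `P` to `Q`. -/
structure IsNullSegment (γ : ℝ → Event) (ℓ : ℝ) (P Q : Event) : Prop where
  isFutureNullGeodesic : IsFutureNullGeodesic γ
  pos : 0 < ℓ
  initial : γ 0 = P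
  terminal : γ ℓ = Q

/-- A lightlike path with `n` segments: the `i`-th segment (`i < n`) is `γ i` on `[0, ℓ i]`, and
runs from `A i` to `A (i + 1)`. Only `A i` for `i ≤ n` and `γ i`, `ℓ i` for `i < n` matter. -/
def IsLightlikePath (n : ℕ) (A : ℕ → Event) (γ : ℕ → ℝ → Event) (ℓ : ℕ → ℝ) : Prop :=
  ∀ i < n, IsNullSegment (γ i) (ℓ i) (A i) (A (i + 1))

/-- There is a lightlike path with exactly `n` segments from `P` to `Q`. -/
def LightlikeConnected (n : ℕ) (P Q : Event) : Prop :=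
  ∃ (A : ℕ → Event) (γ : ℕ → ℝ → Event) (ℓ : ℕ → ℝ),
    IsLightlikePath n A γ ℓ ∧ A 0 = P ∧ A n = Q

/-- The constant of motion `L₁ = g(γ', -∂/∂τ)`, evaluated at parameter value `0`. -/
def L1 (γ : ℝ → Event) : ℝ := -metric (γ 0) (deriv γ 0) partialTau

/-- The constant of motion `L₂ = g(γ', -∂/∂φ)`, evaluated at parameter value `0`. -/
def L2 (γ : ℝ → Event) : ℝ := -metric (γ 0) (deriv γ 0) (partialPhi (γ 0))

/-- The constant of motion `L₃ = g(γ', ∂/∂ζ)`, evaluated at parameter value `0`. -/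
def L3 (γ : ℝ → Event) : ℝ := metric (γ 0) (deriv γ 0) partialZeta

/-- The parameter `κ = L₁ / L₂` of a geodesic with `L₂ > 0`. -/
def kappa (γ : ℝ → Event) : ℝ := L1 γ / L2 γ

/-- The parameter `λ = L₃ / L₂` of a geodesic with `L₂ > 0`. -/
def lam (γ : ℝ → Event) : ℝ := L3 γ / L2 γ

/-- `τ_* = (π / 2)(√2 - 1)`. -/
def tauStar : ℝ := Real.pi / 2 * (Real.sqrt 2 - 1)

/-- The lower bound `κ₁(u)`, for `u ≥ 1`. -/
def kappa1 (u : ℝ) : ℝ :=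
  if u = 1 then 1 / (2 * Real.sqrt 2)
  else (Real.sqrt 2 * u - Real.sqrt (u ^ 2 + u)) / (u * (u - 1))

/-- The upper bound `κ_min(u) = √2 / u`. -/
def kappaMin (u : ℝ) : ℝ := Real.sqrt 2 / u

/-- The radicand `u₀(1 - u₀)κ² + 2√2 u₀ κ - 1`; it vanishes at `κ = κ₁(u₀)`. -/
def envRadicand (u₀ κ : ℝ) : ℝ := u₀ * (1 - u₀) * κ ^ 2 + 2 * Real.sqrt 2 * u₀ * κ - 1

/-- The coordinate `u = r²` of the point of the envelope with parameter `κ`. -/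
def envU (u₀ κ : ℝ) : ℝ := 1 + 2 * Real.sqrt 2 / κ - u₀

/-- The coordinate `τ` of the point of the envelope with parameter `κ`, which is
`τ₀ - π/2 + √2 arctan((√2 κ + 1) / √(envRadicand u₀ κ))`, with `arctan (+∞) = π/2` where the
radicand vanishes. It is written with `arctan t = π/2 - arctan (1/t)`, `t > 0`, so as to cover
this limiting value. -/
def envTau (u₀ τ₀ κ : ℝ) : ℝ :=
  τ₀ - Real.pi / 2 + Real.sqrt 2 *
    (Real.pi / 2 - Real.arctan (Real.sqrt (envRadicand u₀ κ) / (Real.sqrt 2 * κ + 1)))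

theorem envTau_eq (u₀ τ₀ κ : ℝ) (hκ : 0 < κ) (hq : 0 < envRadicand u₀ κ) :
    envTau u₀ τ₀ κ = τ₀ - Real.pi / 2 + Real.sqrt 2 *
      Real.arctan ((Real.sqrt 2 * κ + 1) / Real.sqrt (envRadicand u₀ κ)) := by
  have h : 0 < (Real.sqrt 2 * κ + 1) / Real.sqrt (envRadicand u₀ κ) := by positivity
  have h' := Real.arctan_inv_of_pos h
  rw [inv_div] at h'
  rw [envTau, h']
  ring

/-- The south-east portion of the envelope of the planar future-pointing null geodesics from a
point with `r² = u₀ ≥ 1` and `τ = τ₀`, as a subset of the `(u, τ)`-plane, `u = r²`. -/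
def seEnvelope (u₀ τ₀ : ℝ) : Set (ℝ × ℝ) :=
  {q | ∃ κ ∈ Set.Icc (kappa1 u₀) (kappaMin u₀), q = (envU u₀ κ, envTau u₀ τ₀ κ)}

/-- The future-pointing null geodesic `γ` on `[0, ℓ]` is an initially outgoing SE-segment from
its initial point `P = γ 0`, which lies on or outside the horizon `r = 1`: it is planar, has
`κ ∈ [κ₁(u), √2 / u]` where `u = r(P)²`, has `r' ≥ 0` at `P`, and ends on the south-east portion
of the envelope of the planar future-pointing null geodesics from `P`. -/
structure IsSESegment (γ : ℝ → Event) (ℓ : ℝ) : Prop where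
  isFutureNullGeodesic : IsFutureNullGeodesic γ
  pos : 0 < ℓ
  one_le_radius : 1 ≤ radius (γ 0)
  L2_pos : 0 < L2 γ
  planar : lam γ = 0
  kappa_mem : kappa γ ∈ Set.Icc (kappa1 (radius (γ 0) ^ 2)) (kappaMin (radius (γ 0) ^ 2))
  outgoing : 0 ≤ deriv (fun s => radius (γ s)) 0
  terminal_mem : (radius (γ ℓ) ^ 2, tau (γ ℓ)) ∈ seEnvelope (radius (γ 0) ^ 2) (tau (γ 0))

/-- The geodesic segment `γ'` on `[0, ℓ']` is planar, has the same parameter `κ` as `γ`, and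
retraces `γ` on `[0, ℓ]`: in the `(r, τ)`-plane it is the reflection in `τ = 0` of `γ`
traversed backwards, and it returns in the same way in `ζ`. -/
structure IsReflection (γ' : ℝ → Event) (ℓ' : ℝ) (γ : ℝ → Event) (ℓ : ℝ) : Prop where
  length_eq : ℓ' = ℓ
  L2_pos : 0 < L2 γ'
  planar : lam γ' = 0
  kappa_eq : kappa γ' = kappa γ
  radius_eq : ∀ t ∈ Set.Icc 0 ℓ, radius (γ' t) = radius (γ (ℓ - t))
  tau_eq : ∀ t ∈ Set.Icc 0 ℓ, tau (γ' t) = -tau (γ (ℓ - t))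
  zeta_eq : ∀ t ∈ Set.Icc 0 ℓ, zeta (γ' t) = zeta (γ (ℓ - t))

end

end Godel

namespace Godel

/-! The answer is m = 3, N = 8. It rests on a sharp lower bound for Δτ along one null segment in
terms of the end radii only.

For a null geodesic with L₁ = E, L₂ = ℓ, L₃ = p, the complex number √(1 + r²) exp(iΘ), Θ = (Δτ + E
s)/√2, is a plane harmonic oscillator of frequency ω = √(E² + p²) and angular momentum √2 E + ℓ
(`RadialMotion.oscillator`). With Δ = ω s and β = √2 E / ω ∈ [1, √2] this gives Δτ = √2 Θ - (β/√2) Δ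
and a relation between Δ, Θ, β and the end radii that no longer contains ℓ (`oscillator_relation`).
For end points with r² = a, b ≥ 1, the bound is relaxed first to β = √2 (planar motion) and then to
Δ = π/2 (`angle_bound`); the result is Δτ ≥ `gain a b`. Planar geodesics with Δ = π/2 attain the
bound, and they are the SE-segments (`exists_seSegment`). Inside r ≤ 1 the coordinate τ cannot
decrease, so r² may be replaced by max(r², 1) (`gain_max_le`).

Lower bounds on the number of segments: one segment lowers τ by at most `maxDrop`, and two segments
starting at r ≤ 1 lower it by less than τ_* - `maxDrop`/2 (`two_gain_lower`). Hence two segments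
from (1, τ_*) stay above `maxDrop`/2, so τ = 0 needs three. By symmetry the last two segments start
below -`maxDrop`/2, and a single segment cannot bridge the gap, so six are needed. A closed path
from the axis must leave r ≤ 1; by comparison with the light cone of the axis it does so at τ ≥ τ_*
and finally returns at τ ≤ -τ_*. The first and the last segment have ℓ = 0 and stay in r ≤ 1, so two
more segments are needed (`eight_le_of_closed`).

Existence: three SE-segments through r² = 1, 3.4, 5.8, u₃, with u₃ adjusted by continuity to make
the sum of the gains -τ_*, followed by their mirror images. -/

/-! ### The geodesic equation and the constants of motion -/

theorem metricDeriv_eq (p a v w : Event) :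
    metricDeriv p a v w =
      -Real.sqrt 2 * (rSqDphi a v * w 0 + v 0 * rSqDphi a w)
      - (rSqDphi a v * rSqDphi p w + rSqDphi p v * rSqDphi a w)
      - (rDr a v * rDr p w + rDr p v * rDr a w) / (1 + (p 1 ^ 2 + p 2 ^ 2))
      + rDr p v * rDr p w * (2 * rDr p a) / (1 + (p 1 ^ 2 + p 2 ^ 2)) ^ 2 := by
  have hd : DifferentiableAt ℝ (fun q => metric q v w) p := by
    unfold metric rSqDphi rDr
    have : 1 + (p 1 ^ 2 + p 2 ^ 2) ≠ 0 := by positivity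
    fun_prop (disch := assumption)
  rw [metricDeriv, ← hd.lineDeriv_eq_fderiv]
  have h1 : ∀ i, HasDerivAt (fun t : ℝ => (p + t • a) i) (a i) 0 := by
    intro i
    simpa using ((hasDerivAt_id (0 : ℝ)).mul_const (a i)).const_add (p i)
  have hne : 1 + (((p + (0 : ℝ) • a) 1) ^ 2 + ((p + (0 : ℝ) • a) 2) ^ 2) ≠ 0 := by positivity
  have hphi : ∀ v, HasDerivAt (fun t : ℝ => rSqDphi (p + t • a) v) (rSqDphi a v) 0 := fun v =>
    ((h1 1).mul_const (v 2)).sub ((h1 2).mul_const (v 1))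
  have hr : ∀ v, HasDerivAt (fun t : ℝ => rDr (p + t • a) v) (rDr a v) 0 := fun v =>
    ((h1 1).mul_const (v 1)).add ((h1 2).mul_const (v 2))
  have hden := ((((h1 1).pow 2).add ((h1 2).pow 2)).const_add 1)
  have h := (((((((hphi v).mul_const (w 0)).add ((hphi w).const_mul (v 0))).const_mul
    (Real.sqrt 2)).const_sub (-(v 0 * w 0))).add_const (v 1 * w 1 + v 2 * w 2)).sub
    ((hphi v).mul (hphi w))).sub (((hr v).mul (hr w)).div hden hne) |>.add_const (v 3 * w 3)
  refine h.deriv.trans ?_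
  have hne' : 1 + (p 1 ^ 2 + p 2 ^ 2) ≠ 0 := by positivity
  simp only [zero_smul, add_zero, rDr]
  simp
  field_simp
  ring

/-- The product rule for `g(V, K)` along a curve with velocity `v`. -/
theorem hasDerivAt_metric {γ V K : ℝ → Event} {v a k : Event} {s : ℝ}
    (hγ : HasDerivAt γ v s) (hV : HasDerivAt V a s) (hK : HasDerivAt K k s) :
    HasDerivAt (fun t => metric (γ t) (V t) (K t))
      (metric (γ s) a (K s) + metric (γ s) (V s) k + metricDeriv (γ s) v (V s) (K s)) s := by
  have g := hasDerivAt_pi.1 hγ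
  have hv := hasDerivAt_pi.1 hV
  have hk := hasDerivAt_pi.1 hK
  have hne : 1 + ((γ s 1) ^ 2 + (γ s 2) ^ 2) ≠ 0 := by positivity
  have hphi : ∀ {X : ℝ → Event} {x : Event}, (∀ i, HasDerivAt (fun t => X t i) (x i) s) →
      HasDerivAt (fun t : ℝ => rSqDphi (γ t) (X t)) (rSqDphi v (X s) + rSqDphi (γ s) x) s := by
    intro X x hX
    refine (((g 1).mul (hX 2)).sub ((g 2).mul (hX 1))).congr_deriv ?_
    simp only [rSqDphi]; ring
  have hr : ∀ {X : ℝ → Event} {x : Event}, (∀ i, HasDerivAt (fun t => X t i) (x i) s) →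
      HasDerivAt (fun t : ℝ => rDr (γ t) (X t)) (rDr v (X s) + rDr (γ s) x) s := by
    intro X x hX
    refine (((g 1).mul (hX 1)).add ((g 2).mul (hX 2))).congr_deriv ?_
    simp only [rDr]; ring
  have hden := ((((g 1).pow 2).add ((g 2).pow 2)).const_add 1)
  have h := ((((((hv 0).mul (hk 0)).neg.sub ((((hphi hv).mul (hk 0)).add
    ((hv 0).mul (hphi hk))).const_mul (Real.sqrt 2))).add
    (((hv 1).mul (hk 1)).add ((hv 2).mul (hk 2)))).sub ((hphi hv).mul (hphi hk))).sub
    (((hr hv).mul (hr hk)).div hden hne)).add ((hv 3).mul (hk 3))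
  refine h.congr_deriv ?_
  rw [metricDeriv_eq]
  simp [metric, rDr, rSqDphi]
  field_simp
  ring

/-- `g(∇_γ' γ', w)` at the point `p` of a curve with velocity `v` and second derivative `a`. -/
noncomputable def geodExpr (p v a w : Event) : ℝ :=
  metric p a w + metricDeriv p v v w - 1 / 2 * metricDeriv p w v v

/-- The metric does not depend on τ, so the term (∂_w g)(γ', γ') drops out and what remains is the
derivative of g(γ', ∂/∂τ). -/
theorem geodExpr_tau (p v a : Event) :
    geodExpr p v a partialTau = metric p a partialTau + metricDeriv p v v partialTau := by
  simp [geodExpr, metricDeriv_eq, partialTau, rSqDphi, rDr]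

theorem geodExpr_zeta (p v a : Event) :
    geodExpr p v a partialZeta = metric p a partialZeta + metricDeriv p v v partialZeta := by
  simp [geodExpr, metricDeriv_eq, partialZeta, rSqDphi, rDr]

/-- Here `partialPhi` varies along the curve, with derivative `partialPhi v` by linearity. The
Killing equation for rotations turns the remaining terms into the product rule for g(γ', ∂/∂φ). -/
theorem geodExpr_phi (p v a : Event) :
    geodExpr p v a (partialPhi p) = metric p a (partialPhi p) + metric p v (partialPhi v)
      + metricDeriv p v v (partialPhi p) := by
  have hne : 1 + (p 1 ^ 2 + p 2 ^ 2) ≠ 0 := by positivity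
  simp [geodExpr, metricDeriv_eq, partialPhi, rSqDphi, rDr, metric]
  field_simp
  ring

theorem geodExpr_velocity (p v a : Event) :
    2 * geodExpr p v a v = 2 * metric p a v + metricDeriv p v v v := by
  have hne : 1 + (p 1 ^ 2 + p 2 ^ 2) ≠ 0 := by positivity
  simp [geodExpr, metricDeriv_eq, rSqDphi, rDr, metric]
  field_simp
  ring

theorem metric_comm (p v w : Event) : metric p v w = metric p w v := by
  simp only [metric, rSqDphi, rDr]; ring

theorem hasDerivAt_partialPhi {γ : ℝ → Event} {v : Event} {s : ℝ} (hγ : HasDerivAt γ v s) :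
    HasDerivAt (fun t => partialPhi (γ t)) (partialPhi v) s := by
  have g := hasDerivAt_pi.1 hγ
  refine hasDerivAt_pi.2 fun i => ?_
  fin_cases i <;> simp only [partialPhi]
  · exact hasDerivAt_const _ _
  · exact (g 2).neg
  · exact g 1
  · exact hasDerivAt_const _ _

theorem hasDerivAt_of_contDiff_two {γ : ℝ → Event} (h : ContDiff ℝ 2 γ) (s : ℝ) :
    HasDerivAt γ (deriv γ s) s ∧ HasDerivAt (deriv γ) (deriv (deriv γ) s) s := by
  have h1 : ContDiff ℝ 1 (deriv γ) := ((contDiff_succ_iff_deriv (n := 1)).1 h).2.2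
  exact ⟨(h.differentiable (by norm_num) s).hasDerivAt,
    (h1.differentiable (by norm_num) s).hasDerivAt⟩

theorem const_of_hasDerivAt_zero {f : ℝ → ℝ} (h : ∀ s, HasDerivAt f 0 s) (s t : ℝ) :
    f s = f t :=
  is_const_of_deriv_eq_zero (fun s => (h s).differentiableAt) (fun s => (h s).deriv) s t

namespace IsGeodesic


theorem geodExpr_eq_zero {γ : ℝ → Event} (h : IsGeodesic γ) (s : ℝ) (w : Event) :
    geodExpr (γ s) (deriv γ s) (deriv (deriv γ) s) w = 0 := h.equation s w

theorem metric_partialTau {γ : ℝ → Event} (h : IsGeodesic γ) (s : ℝ) :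
    metric (γ s) (deriv γ s) partialTau = -L1 γ := by
  have key : ∀ s, HasDerivAt (fun t => metric (γ t) (deriv γ t) partialTau) 0 s := by
    intro s
    obtain ⟨h1, h2⟩ := hasDerivAt_of_contDiff_two h.contDiff s
    refine (hasDerivAt_metric h1 h2 (hasDerivAt_const s partialTau)).congr_deriv ?_
    rw [← h.geodExpr_eq_zero s partialTau, geodExpr_tau]
    simp [metric, rSqDphi, rDr]
  rw [L1, neg_neg]
  exact const_of_hasDerivAt_zero key s 0

theorem metric_partialZeta {γ : ℝ → Event} (h : IsGeodesic γ) (s : ℝ) :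
    metric (γ s) (deriv γ s) partialZeta = L3 γ := by
  have key : ∀ s, HasDerivAt (fun t => metric (γ t) (deriv γ t) partialZeta) 0 s := by
    intro s
    obtain ⟨h1, h2⟩ := hasDerivAt_of_contDiff_two h.contDiff s
    refine (hasDerivAt_metric h1 h2 (hasDerivAt_const s partialZeta)).congr_deriv ?_
    rw [← h.geodExpr_eq_zero s partialZeta, geodExpr_zeta]
    simp [metric, rSqDphi, rDr]
  exact const_of_hasDerivAt_zero key s 0

theorem metric_partialPhi {γ : ℝ → Event} (h : IsGeodesic γ) (s : ℝ) :
    metric (γ s) (deriv γ s) (partialPhi (γ s)) = -L2 γ := by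
  have key : ∀ s, HasDerivAt (fun t => metric (γ t) (deriv γ t) (partialPhi (γ t))) 0 s := by
    intro s
    obtain ⟨h1, h2⟩ := hasDerivAt_of_contDiff_two h.contDiff s
    refine (hasDerivAt_metric h1 h2 (hasDerivAt_partialPhi h1)).congr_deriv ?_
    rw [← h.geodExpr_eq_zero s (partialPhi (γ s)), geodExpr_phi]
  rw [L2, neg_neg]
  exact const_of_hasDerivAt_zero key s 0

end IsGeodesic

/-! ### Radial and temporal motion of null geodesics -/

/-- `u = r²` -/
def uu (p : Event) : ℝ := p 1 ^ 2 + p 2 ^ 2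

theorem uu_nonneg (p : Event) : 0 ≤ uu p := by unfold uu; positivity

theorem radius_sq (p : Event) : radius p ^ 2 = uu p := Real.sq_sqrt (uu_nonneg p)

theorem radius_eq_one_iff {p : Event} : radius p = 1 ↔ uu p = 1 := by
  rw [radius, Real.sqrt_eq_one]; rfl

/-- The radial and temporal motion of a null geodesic with constants of motion `L₁ = E`,
`L₂ = ℓ`, `L₃ = p`, in terms of `u = r²`, `R = r r'` and `τ`. -/
structure RadialMotion (E ℓ p : ℝ) (u R τ : ℝ → ℝ) : Prop where
  pos : 0 < E
  sq_le : p ^ 2 ≤ E ^ 2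
  nonneg : ∀ s, 0 ≤ u s
  hasDerivAt_u : ∀ s, HasDerivAt u (2 * R s) s
  hasDerivAt_R : ∀ s, HasDerivAt R
    (-(2 * (E ^ 2 + p ^ 2) * u s) + (E ^ 2 + 2 * Real.sqrt 2 * E * ℓ - p ^ 2)) s
  sq_eq : ∀ s, R s ^ 2 =
    u s * (1 - u s) * E ^ 2 + 2 * Real.sqrt 2 * u s * E * ℓ - ℓ ^ 2 - p ^ 2 * u s * (1 + u s)
  hasDerivAt_τ : ∀ s, HasDerivAt τ (((1 - u s) * E + Real.sqrt 2 * ℓ) / (1 + u s)) s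

theorem metric_tau_eq (p v : Event) :
    metric p v partialTau = -(v 0 + Real.sqrt 2 * rSqDphi p v) := by
  simp [metric, partialTau, rSqDphi, rDr]; ring

theorem metric_zeta_eq (p v : Event) : metric p v partialZeta = v 3 := by
  simp [metric, partialZeta, rSqDphi, rDr]

theorem metric_phi_eq (p v : Event) :
    metric p v (partialPhi p) = -(Real.sqrt 2 * uu p * v 0 - (1 - uu p) * rSqDphi p v) := by
  simp [metric, partialPhi, rSqDphi, rDr, uu]; ring

theorem uu_mul_metric_self (p v : Event) :
    uu p * metric p v v = -(uu p * v 0 ^ 2) - 2 * Real.sqrt 2 * uu p * rSqDphi p v * v 0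
      + rDr p v ^ 2 / (1 + uu p) + (1 - uu p) * rSqDphi p v ^ 2 + uu p * v 3 ^ 2 := by
  have : 1 + (p 1 ^ 2 + p 2 ^ 2) ≠ 0 := by positivity
  simp only [metric, rSqDphi, rDr, uu]
  field_simp
  ring

/-- For null v this is L₃² ≤ L₁², the source of the bound ω ≤ √2 E, that is, β ≥ 1. -/
theorem metric_self_add_sq_nonneg (p v : Event) :
    0 ≤ metric p v v + (v 0 + Real.sqrt 2 * rSqDphi p v) ^ 2 - v 3 ^ 2 := by
  have h2 : Real.sqrt 2 ^ 2 = 2 := Real.sq_sqrt (by norm_num)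
  have hpos : 0 < 1 + (p 1 ^ 2 + p 2 ^ 2) := by positivity
  have : metric p v v + (v 0 + Real.sqrt 2 * rSqDphi p v) ^ 2 - v 3 ^ 2
      = (v 1 ^ 2 + v 2 ^ 2 + (rSqDphi p v ^ 2) * (1 + (p 1 ^ 2 + p 2 ^ 2)) + rSqDphi p v ^ 2)
        / (1 + (p 1 ^ 2 + p 2 ^ 2)) := by
    rw [eq_div_iff hpos.ne']
    simp only [metric, rSqDphi, rDr]
    field_simp
    linear_combination (1 + (p 1 ^ 2 + p 2 ^ 2)) * (p 1 * v 2 - p 2 * v 1) ^ 2 * h2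
  rw [this]
  positivity

theorem rDr_sq_div_of_null {p v : Event} (h : metric p v v = 0) :
    rDr p v ^ 2 / (1 + uu p) = uu p * v 0 ^ 2 + 2 * Real.sqrt 2 * uu p * rSqDphi p v * v 0
      - (1 - uu p) * rSqDphi p v ^ 2 - uu p * v 3 ^ 2 := by
  have := uu_mul_metric_self p v
  rw [h] at this
  linarith

/-- The geodesic equation in the radial direction. -/
theorem geodExpr_radial (p v a : Event) :
    p 1 * a 1 + p 2 * a 2 + (v 1 ^ 2 + v 2 ^ 2) = (1 + uu p) * (v 0 ^ 2 - rSqDphi p v ^ 2 - v 3 ^ 2)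
      + rDr p v ^ 2 / (1 + uu p) + (1 + uu p) * geodExpr p v a ![0, p 1, p 2, 0]
      + (1 + uu p) * metric p v v := by
  have hne : 1 + (p 1 ^ 2 + p 2 ^ 2) ≠ 0 := by positivity
  simp [geodExpr, metricDeriv_eq, rSqDphi, rDr, metric, uu]
  field_simp
  ring

theorem IsFutureNullGeodesic.integrals {γ : ℝ → Event} (h : IsFutureNullGeodesic γ) (s : ℝ) :
    deriv γ s 0 + Real.sqrt 2 * rSqDphi (γ s) (deriv γ s) = L1 γ ∧
    Real.sqrt 2 * uu (γ s) * deriv γ s 0 - (1 - uu (γ s)) * rSqDphi (γ s) (deriv γ s) = L2 γ ∧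
    deriv γ s 3 = L3 γ := by
  have h1 := h.geodesic.metric_partialTau s
  have h2 := h.geodesic.metric_partialPhi s
  have h3 := h.geodesic.metric_partialZeta s
  rw [metric_tau_eq] at h1
  rw [metric_phi_eq] at h2
  rw [metric_zeta_eq] at h3
  exact ⟨by linarith, by linarith, h3⟩

theorem IsFutureNullGeodesic.radialMotion {γ : ℝ → Event} (h : IsFutureNullGeodesic γ) :
    RadialMotion (L1 γ) (L2 γ) (L3 γ) (fun s => uu (γ s))
      (fun s => rDr (γ s) (deriv γ s)) (fun s => tau (γ s)) := by
  have h2 : Real.sqrt 2 ^ 2 = 2 := Real.sq_sqrt (by norm_num)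
  have hpos : ∀ s, 0 < 1 + uu (γ s) := fun s => by have := uu_nonneg (γ s); positivity
  have hv : ∀ s, deriv γ s 0 = ((1 - uu (γ s)) * L1 γ + Real.sqrt 2 * L2 γ) / (1 + uu (γ s)) := by
    intro s
    obtain ⟨e1, e2, -⟩ := h.integrals s
    rw [eq_div_iff (hpos s).ne', ← e1, ← e2]
    linear_combination -(uu (γ s) * deriv γ s 0) * h2
  have hJ : ∀ s, rSqDphi (γ s) (deriv γ s) =
      (Real.sqrt 2 * uu (γ s) * L1 γ - L2 γ) / (1 + uu (γ s)) := by
    intro s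
    obtain ⟨e1, e2, -⟩ := h.integrals s
    rw [eq_div_iff (hpos s).ne', ← e1, ← e2]
    linear_combination -(uu (γ s) * rSqDphi (γ s) (deriv γ s)) * h2
  refine ⟨?_, ?_, fun s => uu_nonneg _, fun s => ?_, fun s => ?_, fun s => ?_, fun s => ?_⟩
  · have := h.future 0
    rw [metric_comm] at this
    rw [L1]; linarith
  · have := metric_self_add_sq_nonneg (γ 0) (deriv γ 0)
    obtain ⟨e1, -, e3⟩ := h.integrals 0
    rw [h.null, e1, e3] at this
    linarith
  · have g := hasDerivAt_pi.1 (hasDerivAt_of_contDiff_two h.geodesic.contDiff s).1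
    refine (((g 1).pow 2).add ((g 2).pow 2)).congr_deriv ?_
    simp [rDr]; ring
  · have g := hasDerivAt_pi.1 (hasDerivAt_of_contDiff_two h.geodesic.contDiff s).1
    have g' := hasDerivAt_pi.1 (hasDerivAt_of_contDiff_two h.geodesic.contDiff s).2
    refine (((g 1).mul (g' 1)).add ((g 2).mul (g' 2))).congr_deriv ?_
    have hE := h.geodesic.geodExpr_eq_zero s ![0, γ s 1, γ s 2, 0]
    have hnull := h.null s
    obtain ⟨e1, e2, e3⟩ := h.integrals s
    have e5 := rDr_sq_div_of_null hnull
    have e6 := geodExpr_radial (γ s) (deriv γ s) (deriv (deriv γ) s)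
    rw [hE, hnull] at e6
    rw [← e1, ← e2, ← e3]
    linear_combination e6 + e5 +
      (rSqDphi (γ s) (deriv γ s) ^ 2 - 2 * uu (γ s) * deriv γ s 0 ^ 2
        - 2 * Real.sqrt 2 * uu (γ s) * deriv γ s 0 * rSqDphi (γ s) (deriv γ s)) * h2
  · have hnull := rDr_sq_div_of_null (h.null s)
    have hden := (hpos s).ne'
    obtain ⟨-, -, e3⟩ := h.integrals s
    have e4 : rDr (γ s) (deriv γ s) ^ 2 = (1 + uu (γ s)) * (uu (γ s) * deriv γ s 0 ^ 2
      + 2 * Real.sqrt 2 * uu (γ s) * rSqDphi (γ s) (deriv γ s) * deriv γ s 0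
      - (1 - uu (γ s)) * rSqDphi (γ s) (deriv γ s) ^ 2 - uu (γ s) * deriv γ s 3 ^ 2) := by
      field_simp at hnull
      linear_combination hnull
    rw [e4, hv, hJ, e3]
    field_simp
    ring_nf
    simp only [show Real.sqrt 2 ^ 3 = 2 * Real.sqrt 2 by rw [pow_succ, h2], h2]
    ring
  · have g := hasDerivAt_pi.1 (hasDerivAt_of_contDiff_two h.geodesic.contDiff s).1
    exact (g 0).congr_deriv (hv s)

/-! ### Trigonometric inequalities for Δτ between given radii -/

theorem sqrt_two_sq : Real.sqrt 2 ^ 2 = 2 := Real.sq_sqrt (by norm_num)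

/-- Since Y sin Θ = (β + ℓ/ω) sin Δ on a geodesic, `hq` expresses ℓ = 0. Such geodesics stay in r ≤
1, so they cannot join two points of r ≥ 1 except at multiples of a half period. Algebraically,
eliminating Θ and squaring gives 4(Y - 1)(Y - β²) + (β² - 1)² sin² Δ ≤ 0, which forces β² = 1 and
then (Y - 1)² ≤ 0. -/
theorem axis_crossing_contradiction {Y β Δ Θ : ℝ} (hY : 2 ≤ Y) (hβ2 : β ^ 2 ≤ 2)
    (hΔ : Real.sin Δ ≠ 0) (hq : Y * Real.sin Θ = β * Real.sin Δ)
    (hG : 2 * Y ≤ 2 * Y * (Real.cos Δ * Real.cos Θ + β * Real.sin Δ * Real.sin Θ)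
      - (β ^ 2 - 1) * Real.sin Δ ^ 2) : False := by
  have hc := Real.sin_sq_add_cos_sq Δ
  have hC := Real.sin_sq_add_cos_sq Θ
  set S := Real.sin Δ ^ 2 with hS
  have hS0 : 0 < S := by positivity
  have hS1 : S ≤ 1 := by nlinarith [sq_nonneg (Real.cos Δ)]
  have h1 : 2 * Y - (β ^ 2 + 1) * S ≤ 2 * (Real.cos Δ * (Y * Real.cos Θ)) := by
    have : 2 * Y * (β * Real.sin Δ * Real.sin Θ) = 2 * β ^ 2 * S := by
      rw [hS]; linear_combination 2 * β * Real.sin Δ * hq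
    linarith
  have h0 : 0 ≤ 2 * Y - (β ^ 2 + 1) * S := by nlinarith
  have h2 := pow_le_pow_left₀ h0 h1 2
  have h3 : (2 * (Real.cos Δ * (Y * Real.cos Θ))) ^ 2 = 4 * (1 - S) * (Y ^ 2 - β ^ 2 * S) := by
    have e1 : Real.cos Δ ^ 2 = 1 - S := by linarith
    have e2 : (Y * Real.cos Θ) ^ 2 = Y ^ 2 - β ^ 2 * S := by
      rw [hS]
      linear_combination Y ^ 2 * hC - (Y * Real.sin Θ + β * Real.sin Δ) * hq
    rw [mul_pow, mul_pow, e1, e2]; ring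
  rw [h3] at h2
  have h4 : S * (4 * (Y - 1) * (Y - β ^ 2) + (β ^ 2 - 1) ^ 2 * S) ≤ 0 := by linarith
  have h5 : 4 * (Y - 1) * (Y - β ^ 2) + (β ^ 2 - 1) ^ 2 * S ≤ 0 := by
    by_contra hcon
    push Not at hcon
    nlinarith [mul_pos hS0 hcon]
  have h6 : 0 ≤ (Y - 1) * (Y - β ^ 2) := mul_nonneg (by linarith) (by linarith)
  have h7 : 0 ≤ (β ^ 2 - 1) ^ 2 * S := by positivity
  have h8 : (β ^ 2 - 1) ^ 2 * S = 0 := by nlinarith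
  have h9 : β ^ 2 = 1 := by
    rcases mul_eq_zero.1 h8 with h | h
    · have := pow_eq_zero_iff (two_ne_zero) |>.1 h; linarith
    · exact absurd h hS0.ne'
  rw [h9] at h5
  nlinarith

/-- As a function of β the expression is a concave quadratic with its maximum at b = Y sin Θ / sin
Δ. If b ≤ √2, then β = b would still satisfy `hG`, against `axis_crossing_contradiction`. So b > √2,
and the expression increases up to the planar value β = √2. -/
theorem planar_of_nonplanar {Y β Δ Θ : ℝ} (hY : 2 ≤ Y) (hβ1 : 1 ≤ β) (hβ2 : β ≤ Real.sqrt 2)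
    (hΔ : 0 < Real.sin Δ) (hq : β * Real.sin Δ ≤ Y * Real.sin Θ)
    (hG : 2 * Y ≤ 2 * Y * (Real.cos Δ * Real.cos Θ + β * Real.sin Δ * Real.sin Θ)
      - (β ^ 2 - 1) * Real.sin Δ ^ 2) :
    Real.sqrt 2 * Real.sin Δ < Y * Real.sin Θ ∧
    2 * Y * (Real.cos Δ * Real.cos Θ + β * Real.sin Δ * Real.sin Θ)
      - (β ^ 2 - 1) * Real.sin Δ ^ 2 ≤
    2 * Y * (Real.cos Δ * Real.cos Θ + Real.sqrt 2 * Real.sin Δ * Real.sin Θ)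
      - Real.sin Δ ^ 2 := by
  have h2 := sqrt_two_sq
  have h : Real.sqrt 2 * Real.sin Δ < Y * Real.sin Θ := by
    by_contra hcon
    push Not at hcon
    set b := Y * Real.sin Θ / Real.sin Δ with hb
    have hb0 : b * Real.sin Δ = Y * Real.sin Θ := by rw [hb]; field_simp
    have hb1 : β ≤ b := by rw [hb, le_div_iff₀ hΔ]; exact hq
    have hb2 : b ≤ Real.sqrt 2 := by rw [hb, div_le_iff₀ hΔ]; exact hcon
    refine axis_crossing_contradiction hY
      (by rw [← h2]; exact pow_le_pow_left₀ (by linarith) hb2 2) hΔ.ne' hb0.symm (hG.trans ?_)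
    have : 0 ≤ ((b - β) * Real.sin Δ) ^ 2 := sq_nonneg _
    linear_combination this + 2 * (b - β) * Real.sin Δ * hb0
  refine ⟨h, ?_⟩
  have : 0 ≤ (Real.sqrt 2 - β) * Real.sin Δ *
      (2 * (Y * Real.sin Θ) - (Real.sqrt 2 + β) * Real.sin Δ) := by
    refine mul_nonneg (mul_nonneg (by linarith) hΔ.le) ?_
    nlinarith
  linear_combination this - Real.sin Δ ^ 2 * h2

/-- For planar motion Δτ = √2 h. With h fixed, Δ is varied up to π/2: the derivative of `M` is √2
cos t · q(t), and q > 0 initially. At a first zero of q the value `M` would still be at least 2 Y,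
which `axis_crossing_contradiction` excludes; so `M` increases all the way. -/
theorem half_circle_of_planar {Y Δ h : ℝ} (hY : 2 ≤ Y) (hΔ : 0 < Δ) (hΔ2 : Δ ≤ Real.pi / 2)
    (hq : Real.sqrt 2 * Real.sin Δ < Y * Real.sin (h + Δ / Real.sqrt 2))
    (hG : 2 * Y ≤ 2 * Y * (Real.cos Δ * Real.cos (h + Δ / Real.sqrt 2)
      + Real.sqrt 2 * Real.sin Δ * Real.sin (h + Δ / Real.sqrt 2)) - Real.sin Δ ^ 2) :
    2 * Y * (Real.cos Δ * Real.cos (h + Δ / Real.sqrt 2)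
      + Real.sqrt 2 * Real.sin Δ * Real.sin (h + Δ / Real.sqrt 2)) - Real.sin Δ ^ 2 ≤
    2 * Real.sqrt 2 * Y * Real.sin (h + Real.pi / 2 / Real.sqrt 2) - 1 := by
  have h2 := sqrt_two_sq
  have hs0 : Real.sqrt 2 ≠ 0 := by positivity
  set M : ℝ → ℝ := fun t => 2 * Y * (Real.cos t * Real.cos (h + t / Real.sqrt 2)
      + Real.sqrt 2 * Real.sin t * Real.sin (h + t / Real.sqrt 2)) - Real.sin t ^ 2 with hM
  set q : ℝ → ℝ := fun t => Y * Real.sin (h + t / Real.sqrt 2) - Real.sqrt 2 * Real.sin t with hqd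
  have hqc : Continuous q := by fun_prop
  have hMc : Continuous M := by fun_prop
  have hMd : ∀ t, HasDerivAt M (Real.sqrt 2 * Real.cos t * q t) t := by
    intro t
    have l : HasDerivAt (fun t : ℝ => h + t / Real.sqrt 2) (1 / Real.sqrt 2) t :=
      ((hasDerivAt_id t).div_const _).const_add h
    refine (((((Real.hasDerivAt_cos t).mul l.cos).add
      (((Real.hasDerivAt_sin t).const_mul (Real.sqrt 2)).mul l.sin)).const_mul (2 * Y)).sub
      ((Real.hasDerivAt_sin t).pow 2)).congr_deriv ?_
    simp only [hqd]
    field_simp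
    linear_combination (Real.cos t * (Y * Real.sin ((h * Real.sqrt 2 + t) / Real.sqrt 2) +
      Real.sqrt 2 * Real.sin t)) * h2
  have mono : ∀ b, b ≤ Real.pi / 2 → (∀ t ∈ Set.Ioo Δ b, 0 ≤ q t) → Δ ≤ b → M Δ ≤ M b := by
    intro b hb hpos hle
    have : MonotoneOn M (Set.Icc Δ b) := by
      refine monotoneOn_of_deriv_nonneg (convex_Icc _ _) hMc.continuousOn
        (fun t _ => (hMd t).differentiableAt.differentiableWithinAt) fun t ht => ?_
      rw [interior_Icc] at ht
      rw [(hMd t).deriv]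
      exact mul_nonneg (mul_nonneg (Real.sqrt_nonneg 2) (Real.cos_nonneg_of_neg_pi_div_two_le_of_le
        (by linarith [ht.1]) (by linarith [ht.2]))) (hpos t ht)
    exact this ⟨le_rfl, hle⟩ ⟨hle, le_rfl⟩ hle
  have hqpos : ∀ t ∈ Set.Icc Δ (Real.pi / 2), 0 < q t := by
    by_contra hcon
    push Not at hcon
    obtain ⟨t0, ht0, ht0q⟩ := hcon
    have hK : IsCompact (Set.Icc Δ (Real.pi / 2) ∩ {t | q t ≤ 0}) :=
      isCompact_Icc.inter_right (isClosed_le hqc continuous_const)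
    obtain ⟨t1, ⟨⟨ht1, ht1'⟩, hq1⟩, hmin⟩ := hK.exists_isLeast ⟨t0, ht0, ht0q⟩
    have hqΔ : 0 < q Δ := by simp only [hqd]; linarith
    have hq0 : q t1 = 0 := by
      obtain ⟨t2, ht2, e⟩ := intermediate_value_Icc' ht1 hqc.continuousOn
        (show (0 : ℝ) ∈ Set.Icc (q t1) (q Δ) from ⟨hq1, hqΔ.le⟩)
      have := hmin ⟨⟨ht2.1, ht2.2.trans ht1'⟩, e.le⟩
      rw [← e, le_antisymm ht2.2 this]
    have hMt := mono t1 ht1' (fun t ht => by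
      by_contra hneg
      push Not at hneg
      have := hmin ⟨⟨ht.1.le, ht.2.le.trans ht1'⟩, hneg.le⟩
      linarith [ht.2]) ht1
    have hsin : Real.sin t1 ≠ 0 :=
      (Real.sin_pos_of_pos_of_lt_pi (by linarith) (by linarith [Real.pi_pos])).ne'
    refine axis_crossing_contradiction (β := Real.sqrt 2) hY
      h2.le hsin (sub_eq_zero.1 hq0) ?_
    rw [h2]
    have := hG.trans hMt
    simp only [hM] at this
    linarith
  have := mono (Real.pi / 2) le_rfl (fun t ht => (hqpos t ⟨ht.1.le, ht.2.le⟩).le) hΔ2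
  simp only [hM, Real.cos_pi_div_two, Real.sin_pi_div_two] at this
  linarith

/-- `Δτ` along a null geodesic segment between points with `r² = a, b ≥ 1` is at least this. -/
noncomputable def gain (a b : ℝ) : ℝ :=
  -(Real.pi / 2) + Real.sqrt 2 *
    Real.arcsin ((a + b + 3) / (2 * Real.sqrt 2 * Real.sqrt ((1 + a) * (1 + b))))

theorem gain_comm (a b : ℝ) : gain a b = gain b a := by
  rw [gain, gain, add_comm a b, mul_comm (1 + a)]

theorem angle_bound {Y W β Δ Θ : ℝ} (hY : 2 ≤ Y) (hW : 2 * Y ≤ W) (hβ1 : 1 ≤ β)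
    (hβ2 : β ≤ Real.sqrt 2) (hΔ : 0 < Δ) (hΔπ : Δ < Real.pi) (hΘ : 0 < Θ)
    (hq : β * Real.sin Δ ≤ Y * Real.sin Θ)
    (hG : W = 2 * Y * (Real.cos Δ * Real.cos Θ + β * Real.sin Δ * Real.sin Θ)
      - (β ^ 2 - 1) * Real.sin Δ ^ 2) :
    -(Real.pi / 2) + Real.sqrt 2 * Real.arcsin ((W + 1) / (2 * Real.sqrt 2 * Y)) ≤
      Real.sqrt 2 * Θ - β / Real.sqrt 2 * Δ := by
  have h2 := sqrt_two_sq
  have hs0 : 0 < Real.sqrt 2 := by positivity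
  have hsΔ : 0 < Real.sin Δ := Real.sin_pos_of_pos_of_lt_pi hΔ hΔπ
  obtain ⟨h1, h3⟩ := planar_of_nonplanar hY hβ1 hβ2 hsΔ hq (hG ▸ hW)
  rw [← hG] at h3
  have key : W ≤ 2 * Real.sqrt 2 * Y *
      Real.sin (Θ - Δ / Real.sqrt 2 + Real.pi / 2 / Real.sqrt 2) - 1 := by
    rcases le_total Δ (Real.pi / 2) with hle | hle
    · have e : Θ - Δ / Real.sqrt 2 + Δ / Real.sqrt 2 = Θ := by ring
      have := half_circle_of_planar (h := Θ - Δ / Real.sqrt 2) hY hΔ hle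
        (by rw [e]; exact h1) (by rw [e]; exact hW.trans h3)
      rw [e] at this
      exact h3.trans this
    -- The substitution Δ ↦ π - Δ, Θ ↦ π - Θ preserves both hypotheses and reduces to Δ ≤ π/2.
    · have e : (Real.pi - Θ - (Real.pi - Δ) / Real.sqrt 2) + (Real.pi - Δ) / Real.sqrt 2
          = Real.pi - Θ := by ring
      have := half_circle_of_planar (h := Real.pi - Θ - (Real.pi - Δ) / Real.sqrt 2)
        (Δ := Real.pi - Δ) hY (by linarith) (by linarith)
        (by rw [e, Real.sin_pi_sub, Real.sin_pi_sub]; exact h1)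
        (by rw [e, Real.sin_pi_sub, Real.sin_pi_sub, Real.cos_pi_sub, Real.cos_pi_sub, neg_mul_neg]
            exact hW.trans h3)
      rw [e, Real.sin_pi_sub, Real.sin_pi_sub, Real.cos_pi_sub, Real.cos_pi_sub, neg_mul_neg,
        show Real.pi - Θ - (Real.pi - Δ) / Real.sqrt 2 + Real.pi / 2 / Real.sqrt 2
          = Real.pi - (Θ - Δ / Real.sqrt 2 + Real.pi / 2 / Real.sqrt 2) by ring,
        Real.sin_pi_sub] at this
      exact h3.trans this
  set θ := Θ - Δ / Real.sqrt 2 + Real.pi / 2 / Real.sqrt 2 with hθ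
  have hs : (W + 1) / (2 * Real.sqrt 2 * Y) ≤ Real.sin θ := by
    rw [div_le_iff₀ (by positivity)]; linarith
  have hspos : 0 < Real.sin θ := lt_of_lt_of_le (div_pos (by linarith) (by positivity)) hs
  have hlow : -(Real.pi / 2) ≤ θ := by
    have a1 : Δ / Real.sqrt 2 ≤ Real.pi / Real.sqrt 2 := by gcongr
    have a2 : Real.pi / Real.sqrt 2 = Real.pi / 2 / Real.sqrt 2 + Real.pi / 2 / Real.sqrt 2 := by
      ring
    have a3 : Real.pi / 2 / Real.sqrt 2 ≤ Real.pi / 2 :=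
      div_le_self (by positivity) (by rw [Real.one_le_sqrt]; norm_num)
    linarith
  have harc : Real.arcsin ((W + 1) / (2 * Real.sqrt 2 * Y)) ≤ θ := by
    rcases lt_or_ge θ (Real.pi / 2) with h | h
    · exact (Real.arcsin_le_iff_le_sin' ⟨hlow, h⟩).2 hs
    · exact (Real.arcsin_le_pi_div_two _).trans h
  have e1 : Real.sqrt 2 * θ = Real.sqrt 2 * Θ - Δ + Real.pi / 2 := by
    rw [hθ]; field_simp
  have e2 : β / Real.sqrt 2 * Δ ≤ Δ := by
    have : β / Real.sqrt 2 ≤ 1 := by rw [div_le_one hs0]; exact hβ2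
    nlinarith
  have := mul_le_mul_of_nonneg_left harc hs0.le
  linarith

/-! ### The harmonic oscillator attached to a null geodesic -/

theorem harmonic_oscillator {f g : ℝ → ℝ} {ω : ℝ} (hω : ω ≠ 0)
    (hf : ∀ s, HasDerivAt f (g s) s) (hg : ∀ s, HasDerivAt g (-(ω ^ 2 * f s)) s) (s : ℝ) :
    f s = f 0 * Real.cos (ω * s) + g 0 / ω * Real.sin (ω * s) := by
  have hl : ∀ s, HasDerivAt (fun t : ℝ => ω * t) ω s := fun s => by
    simpa using (hasDerivAt_id s).const_mul ω
  have h1 : ∀ s, HasDerivAt (fun t => f t * Real.cos (ω * t) - g t / ω * Real.sin (ω * t)) 0 s := by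
    intro s
    refine (((hf s).mul (hl s).cos).sub (((hg s).div_const ω).mul (hl s).sin)).congr_deriv ?_
    field_simp
    ring
  have h2 : ∀ s, HasDerivAt (fun t => f t * Real.sin (ω * t) + g t / ω * Real.cos (ω * t)) 0 s := by
    intro s
    refine (((hf s).mul (hl s).sin).add (((hg s).div_const ω).mul (hl s).cos)).congr_deriv ?_
    field_simp
    ring
  have e1 := const_of_hasDerivAt_zero h1 s 0
  have e2 := const_of_hasDerivAt_zero h2 s 0
  simp only [mul_zero, Real.cos_zero, Real.sin_zero, mul_one, sub_zero, zero_add] at e1 e2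
  have := Real.sin_sq_add_cos_sq (ω * s)
  linear_combination Real.cos (ω * s) * e1 + Real.sin (ω * s) * e2 - f s * this

namespace RadialMotion

variable {E ℓ p : ℝ} {u R τ : ℝ → ℝ}

theorem shift (h : RadialMotion E ℓ p u R τ) (a : ℝ) :
    RadialMotion E ℓ p (fun s => u (s + a)) (fun s => R (s + a)) (fun s => τ (s + a)) where
  pos := h.pos
  sq_le := h.sq_le
  nonneg _ := h.nonneg _
  hasDerivAt_u s := (h.hasDerivAt_u (s + a)).comp_add_const s a
  hasDerivAt_R s := (h.hasDerivAt_R (s + a)).comp_add_const s a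
  sq_eq _ := h.sq_eq _
  hasDerivAt_τ s := (h.hasDerivAt_τ (s + a)).comp_add_const s a

/-- The polar angle of the oscillator `√(1 + u) exp(iΘ)` attached to a null geodesic. -/
noncomputable def angle (E : ℝ) (τ : ℝ → ℝ) (s : ℝ) : ℝ := (τ s - τ 0 + E * s) / Real.sqrt 2

theorem hasDerivAt_angle (h : RadialMotion E ℓ p u R τ) (s : ℝ) :
    HasDerivAt (angle E τ) ((Real.sqrt 2 * E + ℓ) / (1 + u s)) s := by
  have hU : 1 + u s ≠ 0 := by have := h.nonneg s; positivity
  have h2 := sqrt_two_sq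
  have hs0 : Real.sqrt 2 ≠ 0 := by positivity
  have l : HasDerivAt (fun t : ℝ => E * t) E s := by simpa using (hasDerivAt_id s).const_mul E
  refine ((((h.hasDerivAt_τ s).sub_const (τ 0)).add l).div_const (Real.sqrt 2)).congr_deriv ?_
  field_simp
  linear_combination -E * h2

/-- This is the angular momentum of the oscillator, so `angle` increases strictly. If ℓ ≤ -√2 E, the
right side of `sq_eq` would be negative. -/
theorem momentum_pos (h : RadialMotion E ℓ p u R τ) : 0 < Real.sqrt 2 * E + ℓ := by
  have hE := h.pos
  have hu := h.nonneg 0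
  have hQ := h.sq_eq 0
  have h2 := sqrt_two_sq
  have hs0 : 0 < Real.sqrt 2 := by positivity
  by_contra hcon
  push Not at hcon
  have h1 : 2 * E ^ 2 ≤ ℓ ^ 2 := by
    have : (Real.sqrt 2 * E) ^ 2 ≤ (-ℓ) ^ 2 := pow_le_pow_left₀ (by positivity) (by linarith) 2
    nlinarith
  have h3 : 2 * Real.sqrt 2 * u 0 * E * ℓ ≤ -(4 * u 0 * E ^ 2) := by
    have : 0 ≤ 2 * Real.sqrt 2 * u 0 * E * (-(Real.sqrt 2 * E) - ℓ) :=
      mul_nonneg (by positivity) (by linarith)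
    linear_combination this - 2 * u 0 * E ^ 2 * h2
  nlinarith [sq_nonneg (R 0), sq_nonneg (u 0 * E), mul_pos hE hE,
    mul_nonneg (mul_nonneg (sq_nonneg p) hu) (by linarith : 0 ≤ 1 + u 0), mul_nonneg hu (sq_nonneg E)]

/-- The oscillator has frequency `ω`. -/
theorem oscillator (h : RadialMotion E ℓ p u R τ) {ω : ℝ} (hω : 0 < ω)
    (hω2 : ω ^ 2 = E ^ 2 + p ^ 2) (s : ℝ) :
    Real.sqrt (1 + u 0) * Real.sqrt (1 + u s) * Real.cos (angle E τ s)
      = (1 + u 0) * Real.cos (ω * s) + R 0 / ω * Real.sin (ω * s) ∧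
    Real.sqrt (1 + u 0) * Real.sqrt (1 + u s) * Real.sin (angle E τ s)
      = (Real.sqrt 2 * E + ℓ) / ω * Real.sin (ω * s) := by
  have h2 := sqrt_two_sq
  set c := Real.sqrt 2 * E + ℓ with hc
  set ρ : ℝ → ℝ := fun s => Real.sqrt (1 + u s) with hρ
  have hρpos : ∀ s, 0 < ρ s := fun s => Real.sqrt_pos.2 (by have := h.nonneg s; positivity)
  have hρsq : ∀ s, ρ s ^ 2 = 1 + u s := fun s =>
    Real.sq_sqrt (by have := h.nonneg s; positivity)
  have hρd : ∀ s, HasDerivAt ρ (R s / ρ s) s := by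
    intro s
    refine (((h.hasDerivAt_u s).const_add 1).sqrt ?_).congr_deriv ?_
    · have := h.nonneg s; positivity
    · have := (hρpos s).ne'
      simp only [hρ] at this ⊢
      field_simp
  have hθd : ∀ s, HasDerivAt (angle E τ) (c / ρ s ^ 2) s := fun s => by
    rw [hρsq]; exact h.hasDerivAt_angle s
  -- This is ρ'' - c²/ρ³ = -ω² ρ multiplied by ρ³: the radial equation of a plane oscillator with
  -- angular momentum c.
  have key : ∀ s, (-(2 * (E ^ 2 + p ^ 2) * u s) + (E ^ 2 + 2 * Real.sqrt 2 * E * ℓ - p ^ 2)) * ρ s ^ 2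
      - c ^ 2 - R s ^ 2 = -(ω ^ 2 * ρ s ^ 4) := by
    intro s
    rw [h.sq_eq, show ρ s ^ 4 = (ρ s ^ 2) ^ 2 by ring, hρsq, hω2, hc]
    linear_combination -E ^ 2 * h2
  have hθ0 : angle E τ 0 = 0 := by simp [angle]
  constructor
  · have := harmonic_oscillator (f := fun s => ρ s * Real.cos (angle E τ s))
      (g := fun s => (R s * Real.cos (angle E τ s) - c * Real.sin (angle E τ s)) / ρ s)
      hω.ne' (fun s => ?_) (fun s => ?_) s
    · simp only [hθ0, Real.cos_zero, Real.sin_zero] at this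
      have h0 := (hρpos 0).ne'
      rw [mul_assoc, this]
      change ρ 0 * _ = _
      rw [← hρsq 0]
      field_simp
      ring
    · refine ((hρd s).mul (hθd s).cos).congr_deriv ?_
      have := (hρpos s).ne'
      field_simp
      ring
    · have := (hρpos s).ne'
      refine ((((h.hasDerivAt_R s).mul (hθd s).cos).sub ((hθd s).sin.const_mul c)).div
        (hρd s) this).congr_deriv ?_
      simp only [Pi.sub_apply, Pi.mul_apply]
      field_simp
      linear_combination Real.cos (angle E τ s) * key s
  · have := harmonic_oscillator (f := fun s => ρ s * Real.sin (angle E τ s))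
      (g := fun s => (R s * Real.sin (angle E τ s) + c * Real.cos (angle E τ s)) / ρ s)
      hω.ne' (fun s => ?_) (fun s => ?_) s
    · simp only [hθ0, Real.cos_zero, Real.sin_zero] at this
      have h0 := (hρpos 0).ne'
      rw [mul_assoc, this]
      change ρ 0 * _ = _
      field_simp
      ring
    · refine ((hρd s).mul (hθd s).sin).congr_deriv ?_
      have := (hρpos s).ne'
      field_simp
    · have := (hρpos s).ne'
      refine ((((h.hasDerivAt_R s).mul (hθd s).sin).add ((hθd s).cos.const_mul c)).div
        (hρd s) this).congr_deriv ?_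
      simp only [Pi.add_apply, Pi.mul_apply]
      field_simp
      linear_combination Real.sin (angle E τ s) * key s

/-- The squared modulus of the solution at s gives one equation, the radial equation at 0 another;
together they eliminate R(0) and ℓ. -/
theorem oscillator_relation (h : RadialMotion E ℓ p u R τ) {ω : ℝ} (hω : 0 < ω)
    (hω2 : ω ^ 2 = E ^ 2 + p ^ 2) (s : ℝ) :
    (1 + u 0) + (1 + u s) = 2 * Real.sqrt ((1 + u 0) * (1 + u s)) *
      (Real.cos (ω * s) * Real.cos (angle E τ s)
        + Real.sqrt 2 * E / ω * Real.sin (ω * s) * Real.sin (angle E τ s))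
      - ((Real.sqrt 2 * E / ω) ^ 2 - 1) * Real.sin (ω * s) ^ 2 := by
  obtain ⟨e1, e2⟩ := h.oscillator hω hω2 s
  have h2 := sqrt_two_sq
  have hU0 : 0 < 1 + u 0 := by have := h.nonneg 0; positivity
  have hUs : 0 < 1 + u s := by have := h.nonneg s; positivity
  rw [Real.sqrt_mul hU0.le]
  have t1 := Real.sin_sq_add_cos_sq (angle E τ s)
  have t2 := Real.sin_sq_add_cos_sq (ω * s)
  have e3 : (1 + u 0) * (1 + u s) = ((1 + u 0) * Real.cos (ω * s) + R 0 / ω * Real.sin (ω * s)) ^ 2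
      + ((Real.sqrt 2 * E + ℓ) / ω * Real.sin (ω * s)) ^ 2 := by
    rw [← e1, ← e2]
    have a1 := Real.sq_sqrt hU0.le
    have a2 := Real.sq_sqrt hUs.le
    generalize Real.sqrt (1 + u 0) = x at *
    generalize Real.sqrt (1 + u s) = y at *
    rw [← a1, ← a2]
    linear_combination -(x ^ 2 * y ^ 2) * t1
  have e4 : 2 * (Real.sqrt (1 + u 0) * Real.sqrt (1 + u s)) *
      (Real.cos (ω * s) * Real.cos (angle E τ s)
        + Real.sqrt 2 * E / ω * Real.sin (ω * s) * Real.sin (angle E τ s))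
      = 2 * Real.cos (ω * s) * ((1 + u 0) * Real.cos (ω * s) + R 0 / ω * Real.sin (ω * s))
      + 2 * (Real.sqrt 2 * E / ω) * Real.sin (ω * s) *
        ((Real.sqrt 2 * E + ℓ) / ω * Real.sin (ω * s)) := by
    rw [← e1, ← e2]; ring
  rw [e4]
  have hR := h.sq_eq 0
  have hp : p ^ 2 = ω ^ 2 - E ^ 2 := by linarith
  rw [hp] at hR
  refine mul_left_cancel₀ hU0.ne' ?_
  have hω0 := hω.ne'
  have hcos : Real.cos (ω * s) ^ 2 = 1 - Real.sin (ω * s) ^ 2 := by linarith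
  rw [mul_add (1 + u 0) (1 + u 0), e3]
  field_simp
  ring_nf
  simp only [hcos, h2, hR]
  ring

end RadialMotion

/-! ### The lower bound for Δτ along a null geodesic -/

theorem sqrt_two_bounds : 1.41421 < Real.sqrt 2 ∧ Real.sqrt 2 < 1.41422 :=
  ⟨Real.lt_sqrt_of_sq_lt (by norm_num), (Real.sqrt_lt' (by norm_num)).2 (by norm_num)⟩

theorem gain_self_nonpos {a : ℝ} (ha : 1 ≤ a) : gain a a ≤ 0 := by
  obtain ⟨hl, hu⟩ := sqrt_two_bounds
  have hs0 : 0 < Real.sqrt 2 := by positivity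
  have h2 := sqrt_two_sq
  have hpi := Real.pi_gt_d2
  have hpi' := Real.pi_lt_d2
  rw [gain, Real.sqrt_mul_self (by linarith)]
  -- The quotient is largest at a = 1, with value 5/(4√2) ≈ 0.8839, below sin(π/(2√2)) ≈ 0.896.
  have hx : (a + a + 3) / (2 * Real.sqrt 2 * (1 + a)) ≤ 0.8840 := by
    rw [div_le_iff₀ (by positivity)]
    nlinarith
  set d := Real.pi / 2 - Real.pi / 2 / Real.sqrt 2 with hd
  have hmul : Real.pi / 2 / Real.sqrt 2 = Real.pi / 4 * Real.sqrt 2 := by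
    rw [div_eq_iff hs0.ne']; linear_combination -(Real.pi / 4) * h2
  have hdle : d ≤ 0.47 := by rw [hd, hmul]; nlinarith
  have hd0 : 0 ≤ d := by rw [hd, hmul]; nlinarith
  have hcos := Real.one_sub_sq_div_two_le_cos (x := d)
  have hsin : 0.8840 ≤ Real.sin (Real.pi / 2 / Real.sqrt 2) := by
    rw [show Real.pi / 2 / Real.sqrt 2 = Real.pi / 2 - d by rw [hd]; ring, Real.sin_pi_div_two_sub]
    nlinarith
  have harc : Real.arcsin ((a + a + 3) / (2 * Real.sqrt 2 * (1 + a))) ≤ Real.pi / 2 / Real.sqrt 2 :=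
    (Real.arcsin_le_iff_le_sin' ⟨by rw [hmul]; nlinarith, by rw [hmul]; nlinarith⟩).2
      (hx.trans hsin)
  have := mul_le_mul_of_nonneg_left harc hs0.le
  rw [mul_div_cancel₀ _ hs0.ne'] at this
  linarith

namespace RadialMotion

variable {E ℓ p : ℝ} {u R τ : ℝ → ℝ}

theorem angle_strictMono (h : RadialMotion E ℓ p u R τ) : StrictMono (angle E τ) :=
  strictMono_of_deriv_pos fun s => by
    rw [(h.hasDerivAt_angle s).deriv]
    have := h.nonneg s
    exact div_pos h.momentum_pos (by linarith)

theorem angle_zero : angle E τ 0 = 0 := by simp [angle]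

theorem continuous_angle (h : RadialMotion E ℓ p u R τ) : Continuous (angle E τ) :=
  continuous_iff_continuousAt.2 fun s => (h.hasDerivAt_angle s).continuousAt

theorem angle_pos (h : RadialMotion E ℓ p u R τ) {s : ℝ} (hs : 0 < s) : 0 < angle E τ s := by
  have := h.angle_strictMono hs
  rwa [angle_zero] at this

theorem sin_angle_eq_zero_iff (h : RadialMotion E ℓ p u R τ) {ω : ℝ} (hω : 0 < ω)
    (hω2 : ω ^ 2 = E ^ 2 + p ^ 2) (s : ℝ) :
    Real.sin (angle E τ s) = 0 ↔ Real.sin (ω * s) = 0 := by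
  have e := (h.oscillator hω hω2 s).2
  have h1 : 0 < Real.sqrt (1 + u 0) * Real.sqrt (1 + u s) := by
    have := h.nonneg 0
    have := h.nonneg s
    positivity
  have h2 : 0 < (Real.sqrt 2 * E + ℓ) / ω := div_pos h.momentum_pos hω
  constructor
  · intro h0
    rw [h0, mul_zero, eq_comm, mul_eq_zero] at e
    exact e.resolve_left h2.ne'
  · intro h0
    rw [h0, mul_zero, mul_eq_zero] at e
    exact e.resolve_left h1.ne'

theorem angle_le_pi (h : RadialMotion E ℓ p u R τ) {ω : ℝ} (hω : 0 < ω)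
    (hω2 : ω ^ 2 = E ^ 2 + p ^ 2) {s : ℝ} (hs : 0 < s) (hsπ : ω * s ≤ Real.pi) :
    angle E τ s ≤ Real.pi := by
  by_contra hcon
  push Not at hcon
  obtain ⟨t, ht, e⟩ := intermediate_value_Icc hs.le h.continuous_angle.continuousOn
    (show Real.pi ∈ Set.Icc (angle E τ 0) (angle E τ s) from
      ⟨by rw [angle_zero]; exact Real.pi_pos.le, hcon.le⟩)
  have ht0 : 0 < t := by
    rcases ht.1.eq_or_lt with h0 | h0
    · rw [← h0, angle_zero] at e; exact absurd e Real.pi_pos.ne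
    · exact h0
  have hts : t < s := by
    rcases ht.2.eq_or_lt with h0 | h0
    · rw [h0] at e; exact absurd e hcon.ne'
    · exact h0
  have h1 := (h.sin_angle_eq_zero_iff hω hω2 t).1 (by rw [e, Real.sin_pi])
  have h2 := Real.sin_pos_of_pos_of_lt_pi (x := ω * t) (by positivity)
    (lt_of_lt_of_le (mul_lt_mul_of_pos_left hts hω) hsπ)
  exact h2.ne' h1

/-- After phase π the oscillator is at the antipode of its initial position. -/
theorem angle_half_period (h : RadialMotion E ℓ p u R τ) {ω : ℝ} (hω : 0 < ω)
    (hω2 : ω ^ 2 = E ^ 2 + p ^ 2) : angle E τ (Real.pi / ω) = Real.pi ∧ u (Real.pi / ω) = u 0 := by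
  have hs : 0 < Real.pi / ω := by positivity
  have e : ω * (Real.pi / ω) = Real.pi := by field_simp
  have h1 := h.angle_pos hs
  have h2 := h.angle_le_pi hω hω2 hs e.le
  have h3 := (h.sin_angle_eq_zero_iff hω hω2 (Real.pi / ω)).2 (by rw [e, Real.sin_pi])
  have h4 : angle E τ (Real.pi / ω) = Real.pi := by
    rcases h2.eq_or_lt with h5 | h5
    · exact h5
    · exact absurd h3 (Real.sin_pos_of_pos_of_lt_pi h1 h5).ne'
  refine ⟨h4, ?_⟩
  have h5 := (h.oscillator hω hω2 (Real.pi / ω)).1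
  rw [h4, e, Real.cos_pi, Real.sin_pi] at h5
  have a0 : 0 < 1 + u 0 := by have := h.nonneg 0; positivity
  have a1 : 0 < 1 + u (Real.pi / ω) := by have := h.nonneg (Real.pi / ω); positivity
  have h6 : Real.sqrt (1 + u 0) * Real.sqrt (1 + u (Real.pi / ω)) = 1 + u 0 := by linarith
  have h7 := congrArg (· ^ 2) h6
  simp only [mul_pow, Real.sq_sqrt a0.le, Real.sq_sqrt a1.le] at h7
  have : 1 + u (Real.pi / ω) = 1 + u 0 := mul_left_cancel₀ a0.ne' (by linarith)
  linarith

theorem exists_frequency (h : RadialMotion E ℓ p u R τ) :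
    ∃ ω, 0 < ω ∧ ω ^ 2 = E ^ 2 + p ^ 2 ∧ E ≤ ω ∧ ω ≤ Real.sqrt 2 * E := by
  have hE := h.pos
  have h0 : 0 < E ^ 2 + p ^ 2 := by positivity
  refine ⟨Real.sqrt (E ^ 2 + p ^ 2), Real.sqrt_pos.2 h0, Real.sq_sqrt h0.le, ?_, ?_⟩
  · exact Real.le_sqrt_of_sq_le (by nlinarith [sq_nonneg p])
  · refine Real.sqrt_le_iff.2 ⟨by positivity, ?_⟩
    rw [mul_pow, sqrt_two_sq]
    linarith [h.sq_le]

theorem momentum_nonneg_of_one_le (h : RadialMotion E ℓ p u R τ) {s : ℝ} (hu : 1 ≤ u s) :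
    0 ≤ ℓ := by
  have hE := h.pos
  have hQ := h.sq_eq s
  by_contra hcon
  push Not at hcon
  have h1 : u s * (1 - u s) * E ^ 2 ≤ 0 := by
    have : 0 ≤ u s * (u s - 1) * E ^ 2 :=
      mul_nonneg (mul_nonneg (by linarith) (by linarith)) (sq_nonneg _)
    linarith
  have h2 : 0 ≤ 2 * Real.sqrt 2 * u s * E * (-ℓ) := by
    have : 0 ≤ u s := by linarith
    have : 0 ≤ -ℓ := by linarith
    positivity
  have h3 : 0 ≤ p ^ 2 * u s * (1 + u s) := by
    have : 0 ≤ u s := by linarith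
    positivity
  nlinarith [sq_nonneg (R s), mul_pos_of_neg_of_neg hcon hcon]

theorem gain_le_of_lt_half_period (h : RadialMotion E ℓ p u R τ) {ω : ℝ} (hω : 0 < ω)
    (hω2 : ω ^ 2 = E ^ 2 + p ^ 2) (hω3 : E ≤ ω) (hω4 : ω ≤ Real.sqrt 2 * E)
    {s : ℝ} (hs : 0 < s) (hsπ : ω * s < Real.pi)
    (h0 : 1 ≤ u 0) (h1 : 1 ≤ u s) : gain (u 0) (u s) ≤ τ s - τ 0 := by
  have hs0 : 0 < Real.sqrt 2 := by positivity
  set Y := Real.sqrt ((1 + u 0) * (1 + u s)) with hY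
  have hYsq : Y ^ 2 = (1 + u 0) * (1 + u s) := Real.sq_sqrt (by positivity)
  have hY2 : 2 ≤ Y := Real.le_sqrt_of_sq_le (by nlinarith)
  have hW : 2 * Y ≤ (1 + u 0) + (1 + u s) := by
    refine abs_le_of_sq_le_sq' ?_ (by linarith) |>.2
    nlinarith [sq_nonneg (u 0 - u s)]
  have hsin := (h.oscillator hω hω2 s).2
  rw [← Real.sqrt_mul (by linarith)] at hsin
  have hsΔ : 0 < Real.sin (ω * s) := Real.sin_pos_of_pos_of_lt_pi (by positivity) hsπ
  have hb := angle_bound hY2 hW (β := Real.sqrt 2 * E / ω) (Δ := ω * s) (Θ := angle E τ s)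
    (by rw [le_div_iff₀ hω]; linarith)
    (by rw [div_le_iff₀ hω]; exact mul_le_mul_of_nonneg_left hω3 hs0.le)
    (by positivity) hsπ (h.angle_pos hs)
    (by
      rw [hY, hsin]
      refine mul_le_mul_of_nonneg_right ?_ hsΔ.le
      rw [add_div]
      have : 0 ≤ ℓ / ω := div_nonneg (h.momentum_nonneg_of_one_le h0) hω.le
      linarith)
    (h.oscillator_relation hω hω2 s)
  have e : Real.sqrt 2 * angle E τ s - Real.sqrt 2 * E / ω / Real.sqrt 2 * (ω * s)
      = τ s - τ 0 := by
    rw [angle]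
    field_simp
    ring
  rw [e, show 1 + u 0 + (1 + u s) + 1 = u 0 + u s + 3 by ring] at hb
  exact hb

/-- Half periods can be removed one at a time: each returns to the same radius and does not lower τ,
because √2 π ≥ E π / ω. -/
theorem gain_le (h : RadialMotion E ℓ p u R τ) {s : ℝ} (hs : 0 ≤ s)
    (h0 : 1 ≤ u 0) (h1 : 1 ≤ u s) : gain (u 0) (u s) ≤ τ s - τ 0 := by
  obtain ⟨ω, hω, hω2, hω3, hω4⟩ := h.exists_frequency
  have hT : 0 < Real.pi / ω := by positivity
  obtain ⟨n, hn⟩ := exists_nat_gt (s / (Real.pi / ω))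
  rw [div_lt_iff₀ hT] at hn
  induction n generalizing s u R τ with
  | zero => simp at hn; linarith
  | succ n ih =>
    rcases hs.eq_or_lt with rfl | hs'
    · simpa using gain_self_nonpos h0
    rcases lt_or_ge (ω * s) Real.pi with hlt | hge
    · exact h.gain_le_of_lt_half_period hω hω2 hω3 hω4 hs' hlt h0 h1
    · obtain ⟨ha, hu⟩ := h.angle_half_period hω hω2
      have hle : Real.pi / ω ≤ s := by rw [div_le_iff₀ hω]; linarith
      have hτ : τ 0 ≤ τ (Real.pi / ω) := by
        rw [angle, div_eq_iff (by positivity)] at ha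
        have : E * (Real.pi / ω) ≤ Real.pi * 1 := by
          rw [mul_div_assoc', div_le_iff₀ hω]
          nlinarith [Real.pi_pos]
        have : Real.pi * 1 ≤ Real.pi * Real.sqrt 2 :=
          mul_le_mul_of_nonneg_left (by rw [Real.one_le_sqrt]; norm_num) Real.pi_pos.le
        linarith
      have e0 : 0 + Real.pi / ω = Real.pi / ω := zero_add _
      have e1 : s - Real.pi / ω + Real.pi / ω = s := sub_add_cancel _ _
      have := ih (h.shift (Real.pi / ω)) (s := s - Real.pi / ω) (by linarith)
        (by simp only [e0, hu]; exact h0) (by simp only [e1]; exact h1)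
        (by push_cast at hn; linarith)
      simp only [e0, e1, hu] at this
      linarith

/-- Only ℓ < 0 is in doubt; there R² ≥ 0 forces (1 - u) E > 2√2 |ℓ|. -/
theorem deriv_τ_nonneg (h : RadialMotion E ℓ p u R τ) {s : ℝ} (hu : u s ≤ 1) :
    0 ≤ ((1 - u s) * E + Real.sqrt 2 * ℓ) / (1 + u s) := by
  have hE := h.pos
  have hu0 := h.nonneg s
  have hQ := h.sq_eq s
  refine div_nonneg ?_ (by linarith)
  rcases le_or_gt 0 ℓ with hl | hl
  · exact add_nonneg (mul_nonneg (by linarith) hE.le) (by positivity)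
  by_contra hcon
  push Not at hcon
  have h1 : 0 ≤ p ^ 2 * u s * (1 + u s) := by positivity
  have h2 : u s * E * ((1 - u s) * E + 2 * Real.sqrt 2 * ℓ) ≤ 0 := by
    refine mul_nonpos_of_nonneg_of_nonpos (by positivity) ?_
    have : Real.sqrt 2 * ℓ < 0 := mul_neg_of_pos_of_neg (by positivity) hl
    linarith
  nlinarith [sq_nonneg (R s), mul_pos_of_neg_of_neg hl hl]

theorem continuous_u (h : RadialMotion E ℓ p u R τ) : Continuous u :=
  continuous_iff_continuousAt.2 fun s => (h.hasDerivAt_u s).continuousAt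

theorem continuous_τ (h : RadialMotion E ℓ p u R τ) : Continuous τ :=
  continuous_iff_continuousAt.2 fun s => (h.hasDerivAt_τ s).continuousAt

theorem τ_mono_inside (h : RadialMotion E ℓ p u R τ) {a b : ℝ} (hab : a ≤ b)
    (hu : ∀ s ∈ Set.Ioo a b, u s ≤ 1) : τ a ≤ τ b := by
  have : MonotoneOn τ (Set.Icc a b) := by
    refine monotoneOn_of_deriv_nonneg (convex_Icc _ _) h.continuous_τ.continuousOn
      (fun t _ => (h.hasDerivAt_τ t).differentiableAt.differentiableWithinAt) fun t ht => ?_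
    rw [interior_Icc] at ht
    rw [(h.hasDerivAt_τ t).deriv]
    exact h.deriv_τ_nonneg (hu t ht)
  exact this ⟨le_rfl, hab⟩ ⟨hab, le_rfl⟩ hab

/-- On a segment that meets `r ≥ 1` there are a first and a last parameter value with `r ≥ 1`. -/
theorem exists_first_last_outside (h : RadialMotion E ℓ p u R τ) {b : ℝ}
    (hex : ∃ t ∈ Set.Icc 0 b, 1 ≤ u t) :
    ∃ t₁ t₂, 0 ≤ t₁ ∧ t₁ ≤ t₂ ∧ t₂ ≤ b ∧ u t₁ = max (u 0) 1 ∧ u t₂ = max (u b) 1 ∧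
      (∀ t ∈ Set.Icc 0 b, 1 ≤ u t → t₁ ≤ t ∧ t ≤ t₂) := by
  have hK : IsCompact (Set.Icc 0 b ∩ {t | 1 ≤ u t}) :=
    isCompact_Icc.inter_right (isClosed_le continuous_const h.continuous_u)
  obtain ⟨t0, ht0, hu0⟩ := hex
  obtain ⟨t₁, ⟨⟨h1, h1'⟩, hu1⟩, hmin⟩ := hK.exists_isLeast ⟨t0, ht0, hu0⟩
  obtain ⟨t₂, ⟨⟨h2, h2'⟩, hu2⟩, hmax⟩ := hK.exists_isGreatest ⟨t0, ht0, hu0⟩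
  simp only [Set.mem_ofPred_eq] at hu1 hu2
  refine ⟨t₁, t₂, h1, hmin ⟨⟨h2, h2'⟩, hu2⟩, h2', ?_, ?_, fun t ht hu =>
    ⟨hmin ⟨ht, hu⟩, hmax ⟨ht, hu⟩⟩⟩
  · rcases le_or_gt 1 (u 0) with h0 | h0
    · have : t₁ = 0 := le_antisymm (hmin ⟨⟨le_rfl, h1.trans h1'⟩, h0⟩) h1
      rw [this, max_eq_left h0]
    · rw [max_eq_right h0.le]
      obtain ⟨t, ht, e⟩ := intermediate_value_Icc h1 h.continuous_u.continuousOn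
        (show (1 : ℝ) ∈ Set.Icc (u 0) (u t₁) from ⟨h0.le, hu1⟩)
      have := hmin ⟨⟨ht.1, ht.2.trans h1'⟩, e.ge⟩
      rw [← e, le_antisymm ht.2 this]
  · rcases le_or_gt 1 (u b) with h0 | h0
    · have : t₂ = b := le_antisymm h2' (hmax ⟨⟨h2.trans h2', le_rfl⟩, h0⟩)
      rw [this, max_eq_left h0]
    · rw [max_eq_right h0.le]
      obtain ⟨t, ht, e⟩ := intermediate_value_Icc' h2' h.continuous_u.continuousOn
        (show (1 : ℝ) ∈ Set.Icc (u b) (u t₂) from ⟨h0.le, hu2⟩)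
      have := hmax ⟨⟨h2.trans ht.1, ht.2⟩, e.ge⟩
      rw [← e, le_antisymm this ht.1]

/-- Before the first and after the last visit to r ≥ 1 the coordinate τ does not decrease, so only
the part in between matters. Without any visit, `gain 1 1` ≤ 0 suffices. -/
theorem gain_max_le (h : RadialMotion E ℓ p u R τ) {s : ℝ} (hs : 0 ≤ s) :
    gain (max (u 0) 1) (max (u s) 1) ≤ τ s - τ 0 := by
  by_cases hex : ∃ t ∈ Set.Icc 0 s, 1 ≤ u t
  · obtain ⟨t₁, t₂, h1, h12, h2, e1, e2, ht⟩ := h.exists_first_last_outside hex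
    have a1 : τ 0 ≤ τ t₁ := h.τ_mono_inside h1 fun t htt => by
      by_contra hcon
      push Not at hcon
      have := (ht t ⟨htt.1.le, by linarith [htt.2]⟩ hcon.le).1
      linarith [htt.2]
    have a2 : τ t₂ ≤ τ s := h.τ_mono_inside h2 fun t htt => by
      by_contra hcon
      push Not at hcon
      have := (ht t ⟨by linarith [htt.1], htt.2.le⟩ hcon.le).2
      linarith [htt.1]
    have := (h.shift t₁).gain_le (s := t₂ - t₁) (by linarith)
      (by simp only [zero_add]; rw [e1]; exact le_max_right _ _)
      (by simp only [sub_add_cancel]; rw [e2]; exact le_max_right _ _)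
    simp only [zero_add, sub_add_cancel, e1, e2] at this
    linarith
  · push Not at hex
    rw [max_eq_right (hex 0 ⟨le_rfl, hs⟩).le, max_eq_right (hex s ⟨hs, le_rfl⟩).le]
    have := h.τ_mono_inside hs fun t ht => (hex t ⟨ht.1.le, ht.2.le⟩).le
    linarith [gain_self_nonpos (le_refl (1 : ℝ))]

end RadialMotion

/-! ### How far one and two segments can lower τ -/

theorem gain_arg_ge {a b : ℝ} (ha : 1 ≤ a) (hb : 1 ≤ b) :
    Real.sqrt 2 / 2 ≤ (a + b + 3) / (2 * Real.sqrt 2 * Real.sqrt ((1 + a) * (1 + b))) := by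
  have h2 := sqrt_two_sq
  have hY : 0 < Real.sqrt ((1 + a) * (1 + b)) := Real.sqrt_pos.2 (by positivity)
  have hW : Real.sqrt ((1 + a) * (1 + b)) * 2 ≤ a + b + 3 := by
    rw [← le_div_iff₀ (by norm_num)]
    exact Real.sqrt_le_iff.2 ⟨by linarith, by nlinarith [sq_nonneg (a - b)]⟩
  rw [div_le_div_iff₀ (by norm_num) (by positivity)]
  nlinarith

/-- The largest decrease of `τ` along a null geodesic segment. -/
noncomputable def maxDrop : ℝ := Real.pi / 2 - Real.sqrt 2 * (Real.pi / 4)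

theorem neg_maxDrop_le_gain {a b : ℝ} (ha : 1 ≤ a) (hb : 1 ≤ b) : -maxDrop ≤ gain a b := by
  have h : Real.pi / 4 ≤
      Real.arcsin ((a + b + 3) / (2 * Real.sqrt 2 * Real.sqrt ((1 + a) * (1 + b)))) := by
    refine (Real.le_arcsin_iff_sin_le' ⟨?_, ?_⟩).2 ?_
    · linarith [Real.pi_pos]
    · linarith [Real.pi_pos]
    · rw [Real.sin_pi_div_four]; exact gain_arg_ge ha hb
  have := mul_le_mul_of_nonneg_left h (Real.sqrt_nonneg 2)
  rw [gain, maxDrop]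
  linarith

/-- The left side is the tangent at √2/2 to arcsin, which is convex on [0, 1]. With x = sin(π/4 + δ)
the claim is cos δ + sin δ ≤ 1 + δ. -/
theorem arcsin_tangent {x : ℝ} (hx : Real.sqrt 2 / 2 ≤ x) (hx1 : x ≤ 1) :
    Real.pi / 4 - 1 + Real.sqrt 2 * x ≤ Real.arcsin x := by
  have h2 := sqrt_two_sq
  have hx0 : 0 ≤ x := le_trans (by positivity) hx
  set δ := Real.arcsin x - Real.pi / 4 with hδ
  have h0 : 0 ≤ δ := by
    rw [hδ, sub_nonneg]
    refine (Real.le_arcsin_iff_sin_le' ⟨?_, ?_⟩).2 ?_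
    · linarith [Real.pi_pos]
    · linarith [Real.pi_pos]
    · rwa [Real.sin_pi_div_four]
  have e : x = Real.sqrt 2 / 2 * (Real.cos δ + Real.sin δ) := by
    have : Real.sin (Real.pi / 4 + δ) = x := by
      rw [hδ, add_sub_cancel, Real.sin_arcsin (by linarith) hx1]
    rw [← this, Real.sin_add, Real.sin_pi_div_four, Real.cos_pi_div_four]; ring
  have e2 : Real.sqrt 2 * x = Real.cos δ + Real.sin δ := by
    rw [e]; linear_combination (Real.cos δ + Real.sin δ) / 2 * h2
  have e3 : Real.arcsin x = Real.pi / 4 + δ := by rw [hδ]; ring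
  rw [e2, e3]
  linarith [Real.cos_le_one δ, Real.sin_le h0]

/-- The sum equals (t + 1)(2s² + 2t + 1)/(4st). It is least for 2s² = 2t + 1, which leaves (t +
1)²(2t + 1)/t² to be minimized; its minimum is φ⁵ ≈ 11.0902, at the golden ratio t = φ. So the
infimum is √(φ⁵/2) ≈ 2.3548. -/
theorem two_step_quadratic {s t : ℝ} (ht : 0 < t) (hs : 0 < s) :
    2.354 ≤ (2 * s ^ 2 + 3) / (4 * s) + (2 * s ^ 2 + 2 * t ^ 2 + 1) / (4 * s * t) := by
  rw [div_add_div _ _ (by positivity) (by positivity), le_div_iff₀ (by positivity)]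
  have hc : 11.0827 * t ^ 2 ≤ (t + 1) ^ 2 * (2 * t + 1) := by
    -- The cubic that is to be nonnegative is nearly 2(t - φ)²(t + 1/(2φ²)); the decimals
    -- approximate its roots.
    nlinarith [mul_nonneg (sq_nonneg (t - 1.615)) (by linarith : 0 ≤ t + 0.1887)]
  have key : 9.416 * s * t ≤ (t + 1) * (2 * s ^ 2 + 2 * t + 1) := by
    have h1 : (9.416 * s * t) ^ 2 ≤ ((t + 1) * (2 * s ^ 2 + 2 * t + 1)) ^ 2 := by
      have h3 : (9.416 * s * t) ^ 2 ≤ 8 * s ^ 2 * ((t + 1) ^ 2 * (2 * t + 1)) := by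
        nlinarith [mul_le_mul_of_nonneg_left hc (by positivity : 0 ≤ 8 * s ^ 2),
          (by positivity : 0 ≤ s ^ 2 * t ^ 2)]
      nlinarith [sq_nonneg ((t + 1) * (2 * s ^ 2 - (2 * t + 1)))]
    exact abs_le_of_sq_le_sq' h1 (by positivity) |>.2
  nlinarith [mul_le_mul_of_nonneg_left key hs.le]

/-- Replacing arcsin by its tangent makes the sum of the two gains an algebraic function of s = √((1
+ a)/2) and t = √((1 + b)/2), bounded by `two_step_quadratic`. The margin is only about 0.001,
whence the sharp decimals. -/
theorem two_gain_lower {a b : ℝ} (ha : 1 ≤ a) (hb : 1 ≤ b) :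
    -tauStar + maxDrop / 2 < gain 1 a + gain a b := by
  obtain ⟨hl, hu⟩ := sqrt_two_bounds
  have h2 := sqrt_two_sq
  have hpi := Real.pi_gt_d6
  have hpi' := Real.pi_lt_d6
  -- An argument above 1 makes `Real.arcsin` take its cut-off value π/2; the gain is then τ_*, and
  -- the trivial bound -`maxDrop` for the other segment is enough.
  have big : ∀ {x y : ℝ},
      1 < (x + y + 3) / (2 * Real.sqrt 2 * Real.sqrt ((1 + x) * (1 + y))) →
      gain x y = tauStar := by
    intro x y h
    rw [gain, Real.arcsin_of_one_le h.le, tauStar]; ring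
  rcases lt_or_ge 1 ((1 + a + 3) / (2 * Real.sqrt 2 * Real.sqrt ((1 + 1) * (1 + a)))) with h1 | h1
  · have := neg_maxDrop_le_gain ha hb
    rw [big h1]
    rw [maxDrop, tauStar] at *
    nlinarith
  rcases lt_or_ge 1 ((a + b + 3) / (2 * Real.sqrt 2 * Real.sqrt ((1 + a) * (1 + b)))) with h3 | h3
  · have := neg_maxDrop_le_gain le_rfl ha
    rw [big h3]
    rw [maxDrop, tauStar] at *
    nlinarith
  have t1 := arcsin_tangent (gain_arg_ge le_rfl ha) h1
  have t2 := arcsin_tangent (gain_arg_ge ha hb) h3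
  set s := Real.sqrt ((1 + a) / 2) with hs
  set t := Real.sqrt ((1 + b) / 2) with ht
  have hs0 : 0 < s := Real.sqrt_pos.2 (by linarith)
  have ht0 : 0 < t := Real.sqrt_pos.2 (by linarith)
  have ea : 1 + a = 2 * s ^ 2 := by rw [hs, Real.sq_sqrt (by linarith)]; ring
  have eb : 1 + b = 2 * t ^ 2 := by rw [ht, Real.sq_sqrt (by linarith)]; ring
  have r1 : Real.sqrt ((1 + 1) * (1 + a)) = 2 * s := by
    rw [ea, show (1 + 1) * (2 * s ^ 2) = (2 * s) ^ 2 by ring, Real.sqrt_sq (by positivity)]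
  have r2 : Real.sqrt ((1 + a) * (1 + b)) = 2 * s * t := by
    rw [ea, eb, show 2 * s ^ 2 * (2 * t ^ 2) = (2 * s * t) ^ 2 by ring,
      Real.sqrt_sq (by positivity)]
  have q1 : Real.sqrt 2 * ((1 + a + 3) / (2 * Real.sqrt 2 * (2 * s))) = (2 * s ^ 2 + 3) / (4 * s) := by
    rw [ea]; field_simp; ring
  have q2 : Real.sqrt 2 * ((a + b + 3) / (2 * Real.sqrt 2 * (2 * s * t)))
      = (2 * s ^ 2 + 2 * t ^ 2 + 1) / (4 * s * t) := by
    rw [show a + b + 3 = 2 * s ^ 2 + 2 * t ^ 2 + 1 by linarith]; field_simp; ring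
  rw [r1, q1] at t1
  rw [r2, q2] at t2
  have hsum := two_step_quadratic ht0 hs0
  rw [gain, gain, r1, r2, tauStar, maxDrop]
  generalize Real.arcsin ((1 + a + 3) / (2 * Real.sqrt 2 * (2 * s))) = A at *
  generalize Real.arcsin ((a + b + 3) / (2 * Real.sqrt 2 * (2 * s * t))) = B at *
  have hAB : Real.pi / 2 - 2 + 2.354 ≤ A + B := by linarith
  have := mul_le_mul_of_nonneg_left hAB (Real.sqrt_nonneg 2)
  nlinarith

/-! ### Counting segments between (1, τ_*) and (1, -τ_*) -/

/-- The bound on `Δτ` that holds along every null geodesic segment from `p` to `q`. -/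
def Step (p q : Event) : Prop := gain (max (uu p) 1) (max (uu q) 1) ≤ tau q - tau p

theorem IsFutureNullGeodesic.step {γ : ℝ → Event} (h : IsFutureNullGeodesic γ) {a b : ℝ}
    (hab : a ≤ b) : Step (γ a) (γ b) := by
  have := (h.radialMotion.shift a).gain_max_le (s := b - a) (by linarith)
  rw [Step]
  simpa using this

theorem IsNullSegment.step {γ : ℝ → Event} {l : ℝ} {P Q : Event} (h : IsNullSegment γ l P Q) :
    Step P Q := by
  rw [← h.initial, ← h.terminal]
  exact h.isFutureNullGeodesic.step h.pos.le

theorem maxDrop_pos : 0 < maxDrop := by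
  obtain ⟨-, hu⟩ := sqrt_two_bounds
  rw [maxDrop]
  nlinarith [Real.pi_pos]

theorem tauStar_gt : maxDrop / 2 < tauStar := by
  obtain ⟨hl, hu⟩ := sqrt_two_bounds
  rw [maxDrop, tauStar]
  nlinarith [Real.pi_pos]

theorem gain_one_lower {a : ℝ} (ha : 1 ≤ a) : -tauStar + maxDrop / 2 < gain 1 a := by
  have := two_gain_lower ha ha
  have := gain_self_nonpos ha
  linarith

/-- Two segments from `(r, τ) = (1, τ_*)` do not reach `τ = maxDrop / 2`. -/
theorem forward_bound {n : ℕ} (hn : n ≤ 2) {B : ℕ → Event} (hB : ∀ k < n, Step (B k) (B (k + 1)))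
    (h1 : uu (B 0) ≤ 1) (h2 : tauStar ≤ tau (B 0)) : maxDrop / 2 < tau (B n) := by
  have e0 : max (uu (B 0)) 1 = 1 := max_eq_right h1
  interval_cases n
  · linarith [tauStar_gt]
  · have s0 := hB 0 (by norm_num)
    rw [Step, e0] at s0
    have := gain_one_lower (le_max_right (uu (B (0 + 1))) 1)
    simp only [zero_add] at *
    linarith
  · have s0 := hB 0 (by norm_num)
    have s1 := hB 1 (by norm_num)
    rw [Step, e0] at s0
    rw [Step] at s1
    have := two_gain_lower (le_max_right (uu (B 1)) 1) (le_max_right (uu (B 2)) 1)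
    simp only [zero_add, one_add_one_eq_two] at *
    linarith

theorem backward_bound {n j : ℕ} (hj : j ≤ n) (hn : n ≤ j + 2) {B : ℕ → Event}
    (hB : ∀ k < n, Step (B k) (B (k + 1)))
    (h1 : uu (B n) ≤ 1) (h2 : tau (B n) ≤ -tauStar) : tau (B j) < -(maxDrop / 2) := by
  have e0 : max (uu (B n)) 1 = 1 := max_eq_right h1
  obtain ⟨i, rfl⟩ := Nat.exists_eq_add_of_le hj
  have hi : i ≤ 2 := by omega
  interval_cases i
  · have := tauStar_gt
    simp only [add_zero] at *
    linarith
  · have s0 := hB j (by omega)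
    rw [Step, e0, gain_comm] at s0
    have := gain_one_lower (le_max_right (uu (B j)) 1)
    linarith
  · have s0 := hB j (by omega)
    have s1 := hB (j + 1) (by omega)
    rw [Step, gain_comm] at s0
    rw [Step, add_assoc, one_add_one_eq_two, e0, gain_comm] at s1
    have := two_gain_lower (le_max_right (uu (B (j + 1))) 1) (le_max_right (uu (B j)) 1)
    linarith

/-- With at most four steps, one point lies within two steps of both ends, so its τ is both above
`maxDrop`/2 and below -`maxDrop`/2. With five, the middle step would have to lower τ by more than
`maxDrop`. Only `Step` is used, so the ends may also be interior points of segments. -/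
theorem six_le_of_steps {n : ℕ} {B : ℕ → Event} (hB : ∀ k < n, Step (B k) (B (k + 1)))
    (h1 : uu (B 0) ≤ 1) (h2 : tauStar ≤ tau (B 0))
    (h3 : uu (B n) ≤ 1) (h4 : tau (B n) ≤ -tauStar) : 6 ≤ n := by
  by_contra hcon
  push Not at hcon
  have hp := maxDrop_pos
  rcases le_or_gt n 4 with hn | hn
  · have a := forward_bound (n := min n 2) (by omega) (fun k hk => hB k (by omega)) h1 h2
    have b := backward_bound (j := min n 2) (by omega) (by omega) hB h3 h4
    linarith
  · obtain rfl : n = 5 := by omega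
    have a := forward_bound (n := 2) le_rfl (fun k hk => hB k (by omega)) h1 h2
    have b := backward_bound (j := 3) (by omega) (by omega) hB h3 h4
    have c := hB 2 (by norm_num)
    have d := neg_maxDrop_le_gain (le_max_right (uu (B 2)) 1) (le_max_right (uu (B (2 + 1))) 1)
    rw [Step] at c
    norm_num at *
    linarith

theorem three_le_of_steps {n : ℕ} {B : ℕ → Event} (hB : ∀ k < n, Step (B k) (B (k + 1)))
    (h1 : uu (B 0) ≤ 1) (h2 : tauStar ≤ tau (B 0)) (h3 : tau (B n) ≤ 0) : 3 ≤ n := by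
  by_contra hcon
  push Not at hcon
  have a := forward_bound (n := n) (by omega) hB h1 h2
  linarith [maxDrop_pos]

/-! ### Geodesics through the axis and its light cone inside r ≤ 1 -/

/-- The time that a null geodesic from the axis takes, at parameter value `s`. -/
noncomputable def axialTau (s : ℝ) : ℝ :=
  ∫ t in (0 : ℝ)..s, Real.cos t ^ 2 / (1 + Real.sin t ^ 2)

theorem hasDerivAt_axialTau (s : ℝ) :
    HasDerivAt axialTau (Real.cos s ^ 2 / (1 + Real.sin s ^ 2)) s := by
  have hc : Continuous fun t : ℝ => Real.cos t ^ 2 / (1 + Real.sin t ^ 2) := by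
    have : ∀ t : ℝ, 1 + Real.sin t ^ 2 ≠ 0 := fun t => by positivity
    fun_prop (disch := assumption)
  exact (hc.integral_hasStrictDerivAt 0 _).hasDerivAt

theorem axialTau_zero : axialTau 0 = 0 := by simp [axialTau]

theorem axial_radialMotion :
    RadialMotion 1 0 0 (fun s => Real.sin s ^ 2) (fun s => Real.sin s * Real.cos s) axialTau where
  pos := one_pos
  sq_le := by norm_num
  nonneg s := sq_nonneg _
  hasDerivAt_u s := ((Real.hasDerivAt_sin s).pow 2).congr_deriv (by ring)
  hasDerivAt_R s := ((Real.hasDerivAt_sin s).mul (Real.hasDerivAt_cos s)).congr_deriv (by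
    have := Real.sin_sq_add_cos_sq s
    linear_combination this)
  sq_eq s := by
    have := Real.sin_sq_add_cos_sq s
    linear_combination Real.sin s ^ 2 * this
  hasDerivAt_τ s := (hasDerivAt_axialTau s).congr_deriv (by
    have := Real.sin_sq_add_cos_sq s
    congr 1
    linear_combination this)

/-- The integral is read off from the oscillator: at s = π/2 its angle is π/2. -/
theorem axialTau_pi_div_two : axialTau (Real.pi / 2) = tauStar := by
  have h := axial_radialMotion
  have h1 := (h.oscillator one_pos (by norm_num) (Real.pi / 2)).1
  simp only [one_mul, Real.cos_pi_div_two, Real.sin_zero, zero_mul, mul_zero, zero_div,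
    add_zero] at h1
  have h2 := h.angle_pos (s := Real.pi / 2) (by positivity)
  have h3 := h.angle_le_pi (s := Real.pi / 2) one_pos (by norm_num) (by positivity)
    (by linarith [Real.pi_pos])
  have h4 : Real.cos (RadialMotion.angle 1 axialTau (Real.pi / 2)) = 0 := by
    rcases mul_eq_zero.1 h1 with h5 | h5
    · have : 0 < Real.sqrt (1 + Real.sin 0 ^ 2) * Real.sqrt (1 + Real.sin (Real.pi / 2) ^ 2) := by
        positivity
      simp at this h5
    · exact h5
  have h5 : RadialMotion.angle 1 axialTau (Real.pi / 2) = Real.pi / 2 :=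
    Real.injOn_cos ⟨h2.le, h3⟩ ⟨by positivity, by linarith [Real.pi_pos]⟩
      (by rw [h4, Real.cos_pi_div_two])
  rw [RadialMotion.angle, div_eq_iff (by positivity), axialTau_zero] at h5
  rw [tauStar]
  linarith

/-- The least time in which a causal curve can reach radius `r ≤ 1` from the axis without leaving
the cylinder of radius `1`. -/
noncomputable def coneTime (r : ℝ) : ℝ := ∫ t in (0 : ℝ)..r, Real.sqrt (1 - t ^ 2) / (1 + t ^ 2)

theorem hasDerivAt_coneTime (r : ℝ) :
    HasDerivAt coneTime (Real.sqrt (1 - r ^ 2) / (1 + r ^ 2)) r := by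
  have hc : Continuous fun t : ℝ => Real.sqrt (1 - t ^ 2) / (1 + t ^ 2) := by
    have : ∀ t : ℝ, 1 + t ^ 2 ≠ 0 := fun t => by positivity
    fun_prop (disch := assumption)
  exact (hc.integral_hasStrictDerivAt 0 _).hasDerivAt

theorem coneTime_zero : coneTime 0 = 0 := by simp [coneTime]

theorem coneTime_nonneg {r : ℝ} (hr : 0 ≤ r) : 0 ≤ coneTime r :=
  intervalIntegral.integral_nonneg hr fun t _ => by positivity

/-- The substitution r = sin s turns `coneTime` into `axialTau`. -/
theorem coneTime_one : coneTime 1 = tauStar := by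
  have hd : ∀ s ∈ Set.Ioo 0 (Real.pi / 2),
      HasDerivAt (fun s => coneTime (Real.sin s) - axialTau s) 0 s := by
    intro s hs
    have hcos : 0 ≤ Real.cos s := Real.cos_nonneg_of_neg_pi_div_two_le_of_le
      (by linarith [hs.1, Real.pi_pos]) hs.2.le
    refine (((hasDerivAt_coneTime (Real.sin s)).comp s (Real.hasDerivAt_sin s)).sub
      (hasDerivAt_axialTau s)).congr_deriv ?_
    rw [← Real.abs_cos_eq_sqrt_one_sub_sin_sq, abs_of_nonneg hcos]
    ring
  have hcont : Continuous fun s => coneTime (Real.sin s) - axialTau s :=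
    (Continuous.comp (continuous_iff_continuousAt.2 fun r => (hasDerivAt_coneTime r).continuousAt)
      Real.continuous_sin).sub
      (continuous_iff_continuousAt.2 fun r => (hasDerivAt_axialTau r).continuousAt)
  have hpi : 0 < Real.pi / 2 := by positivity
  obtain ⟨c, hc, e⟩ := exists_hasDerivAt_eq_slope (fun s => coneTime (Real.sin s) - axialTau s)
    (fun _ => 0) hpi hcont.continuousOn hd
  rw [eq_comm, div_eq_zero_iff] at e
  have e' := e.resolve_right (by linarith)
  simp only [Real.sin_pi_div_two, Real.sin_zero, coneTime_zero, axialTau_zero,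
    axialTau_pi_div_two] at e'
  linarith

namespace RadialMotion

variable {E ℓ p : ℝ} {u R τ : ℝ → ℝ}

theorem reverse (h : RadialMotion E ℓ p u R τ) :
    RadialMotion E ℓ p (fun s => u (-s)) (fun s => -R (-s)) (fun s => -τ (-s)) where
  pos := h.pos
  sq_le := h.sq_le
  nonneg _ := h.nonneg _
  hasDerivAt_u s := ((h.hasDerivAt_u (-s)).scomp s (hasDerivAt_neg s)).congr_deriv (by simp)
  hasDerivAt_R s := ((h.hasDerivAt_R (-s)).scomp s (hasDerivAt_neg s)).neg.congr_deriv (by simp)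
  sq_eq s := by rw [neg_sq]; exact h.sq_eq _
  hasDerivAt_τ s := ((h.hasDerivAt_τ (-s)).scomp s (hasDerivAt_neg s)).neg.congr_deriv (by simp)

/-- The claim is that τ - `coneTime` r does not decrease. After squaring, the derivative inequality
has the excess (1 + u) ℓ² + (1 - u) u (1 + u) p² ≥ 0. Positivity of u keeps r = √u differentiable.
-/
theorem cone_of_pos (h : RadialMotion E ℓ p u R τ) {a b : ℝ} (hab : a ≤ b)
    (hu : ∀ s ∈ Set.Ioo a b, u s ≤ 1) (hu0 : ∀ s ∈ Set.Ioo a b, 0 < u s) :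
    coneTime (Real.sqrt (u b)) - coneTime (Real.sqrt (u a)) ≤ τ b - τ a := by
  have hd : ∀ s ∈ Set.Ioo a b, HasDerivAt (fun s => τ s - coneTime (Real.sqrt (u s)))
      (((1 - u s) * E + Real.sqrt 2 * ℓ) / (1 + u s)
        - Real.sqrt (1 - u s) / (1 + u s) * (R s / Real.sqrt (u s))) s := by
    intro s hs
    have := ((hasDerivAt_coneTime (Real.sqrt (u s))).comp s
      ((h.hasDerivAt_u s).sqrt (hu0 s hs).ne'))
    rw [Real.sq_sqrt (hu0 s hs).le] at this
    refine ((h.hasDerivAt_τ s).sub this).congr_deriv ?_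
    rw [mul_div_mul_left _ _ two_ne_zero]
  have hcone : Continuous coneTime :=
    continuous_iff_continuousAt.2 fun r => (hasDerivAt_coneTime r).continuousAt
  have : MonotoneOn (fun s => τ s - coneTime (Real.sqrt (u s))) (Set.Icc a b) := by
    refine monotoneOn_of_deriv_nonneg (convex_Icc _ _)
      (h.continuous_τ.sub (hcone.comp h.continuous_u.sqrt)).continuousOn
      (fun t ht => ?_) fun t ht => ?_
    · rw [interior_Icc] at ht
      exact (hd t ht).differentiableAt.differentiableWithinAt
    · rw [interior_Icc] at ht
      rw [(hd t ht).deriv]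
      have hpos := hu0 t ht
      have h1 := hu t ht
      have hn := h.deriv_τ_nonneg h1
      have hden : 0 < 1 + u t := by linarith
      have hsq : 0 < Real.sqrt (u t) := Real.sqrt_pos.2 hpos
      rw [le_div_iff₀ hden, zero_mul] at hn
      rw [sub_nonneg, div_mul_eq_mul_div, div_le_div_iff_of_pos_right hden, mul_div_assoc',
        div_le_iff₀ hsq]
      refine abs_le_of_sq_le_sq' ?_ (by positivity) |>.2
      rw [mul_pow, mul_pow, Real.sq_sqrt (by linarith), Real.sq_sqrt hpos.le, h.sq_eq]
      have h2 := sqrt_two_sq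
      have q1 : 0 ≤ (1 + u t) * ℓ ^ 2 := by positivity
      have q2 : 0 ≤ (1 - u t) * (u t * (1 + u t)) * p ^ 2 :=
        mul_nonneg (mul_nonneg (by linarith) (by positivity)) (sq_nonneg p)
      linear_combination q1 + q2 - u t * ℓ ^ 2 * h2
  have := this ⟨le_rfl, hab⟩ ⟨hab, le_rfl⟩ hab
  simp only at this
  linarith

/-- Inside `r ≤ 1` a null geodesic stays in the cone. -/
theorem cone (h : RadialMotion E ℓ p u R τ) {a b : ℝ} (hab : a ≤ b)
    (hu : ∀ s ∈ Set.Ioo a b, u s ≤ 1) :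
    coneTime (Real.sqrt (u b)) - coneTime (Real.sqrt (u a)) ≤ τ b - τ a := by
  by_cases hex : ∃ t ∈ Set.Icc a b, u t ≤ 0
  -- The interval is split at the last passage through the axis, where `coneTime` vanishes. Up to
  -- there, monotonicity of τ is enough.
  · have hK : IsCompact (Set.Icc a b ∩ {t | u t ≤ 0}) :=
      isCompact_Icc.inter_right (isClosed_le h.continuous_u continuous_const)
    obtain ⟨t0, ht0, hu0⟩ := hex
    obtain ⟨t, ⟨ht, htu⟩, hmax⟩ := hK.exists_isGreatest ⟨t0, ht0, hu0⟩
    have h0 : u t = 0 := le_antisymm htu (h.nonneg t)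
    have e1 := h.cone_of_pos ht.2 (fun s hs => hu s ⟨ht.1.trans_lt hs.1, hs.2⟩) fun s hs => by
      by_contra hcon
      push Not at hcon
      have := hmax ⟨⟨ht.1.trans hs.1.le, hs.2.le⟩, hcon⟩
      linarith [hs.1]
    have e2 := h.τ_mono_inside ht.1 fun s hs => hu s ⟨hs.1, hs.2.trans_le ht.2⟩
    have e3 := coneTime_nonneg (Real.sqrt_nonneg (u a))
    rw [h0, Real.sqrt_zero, coneTime_zero] at e1
    linarith
  · push Not at hex
    exact h.cone_of_pos hab hu fun s hs => hex s ⟨hs.1.le, hs.2.le⟩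

theorem cone_reverse (h : RadialMotion E ℓ p u R τ) {a b : ℝ} (hab : a ≤ b)
    (hu : ∀ s ∈ Set.Ioo a b, u s ≤ 1) :
    coneTime (Real.sqrt (u a)) - coneTime (Real.sqrt (u b)) ≤ τ b - τ a := by
  have := h.reverse.cone (neg_le_neg hab) fun s hs => hu (-s)
    ⟨by linarith [hs.2], by linarith [hs.1]⟩
  simp only [neg_neg] at this
  linarith

theorem le_one_of_axial {E p : ℝ} {u R τ : ℝ → ℝ} (h : RadialMotion E 0 p u R τ) (s : ℝ) :
    u s ≤ 1 := by
  have hE := h.pos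
  have hu := h.nonneg s
  have hQ := h.sq_eq s
  by_contra hcon
  push Not at hcon
  have h1 : 0 ≤ p ^ 2 * u s * (1 + u s) := by positivity
  have h2 : 0 < u s * (u s - 1) * E ^ 2 :=
    mul_pos (mul_pos (by linarith) (by linarith)) (by positivity)
  nlinarith [sq_nonneg (R s)]

/-- The strict inequality rules out closed paths that never leave r ≤ 1. -/
theorem τ_lt_of_axial {E p : ℝ} {u R τ : ℝ → ℝ} (h : RadialMotion E 0 p u R τ)
    (h0 : u 0 = 0) {b : ℝ} (hb : 0 < b) : τ 0 < τ b := by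
  have hev : ∀ᶠ s in nhds (0 : ℝ), u s < 1 :=
    h.continuous_u.continuousAt.eventually_lt continuousAt_const (by rw [h0]; norm_num)
  obtain ⟨ε, hε, hball⟩ := Metric.eventually_nhds_iff.1 hev
  set d := min (ε / 2) b with hd
  have hd0 : 0 < d := lt_min (by linarith) hb
  have hdε : d < ε := (min_le_left _ _).trans_lt (by linarith)
  have hmono : StrictMonoOn τ (Set.Icc 0 d) := by
    refine strictMonoOn_of_deriv_pos (convex_Icc _ _) h.continuous_τ.continuousOn fun t ht => ?_
    rw [interior_Icc] at ht
    have : u t < 1 := hball (by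
      rw [Real.dist_eq, sub_zero, abs_of_pos ht.1]; linarith [ht.2])
    rw [(h.hasDerivAt_τ t).deriv, mul_zero, add_zero]
    have := h.nonneg t
    exact div_pos (mul_pos (by linarith) h.pos) (by linarith)
  exact (hmono ⟨le_rfl, hd0.le⟩ ⟨hd0.le, le_rfl⟩ hd0).trans_le
    (h.τ_mono_inside (min_le_right _ _) fun s _ => h.le_one_of_axial s)

end RadialMotion

theorem partialPhi_of_axis {p : Event} (h : uu p = 0) : partialPhi p = 0 := by
  have h1 : p 1 = 0 := by unfold uu at h; nlinarith [sq_nonneg (p 1), sq_nonneg (p 2)]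
  have h2 : p 2 = 0 := by unfold uu at h; nlinarith [sq_nonneg (p 1), sq_nonneg (p 2)]
  funext i
  fin_cases i <;> simp [partialPhi, h1, h2]

theorem IsFutureNullGeodesic.L2_eq_zero {γ : ℝ → Event} (h : IsFutureNullGeodesic γ) {s : ℝ}
    (hs : uu (γ s) = 0) : L2 γ = 0 := by
  have := h.geodesic.metric_partialPhi s
  rw [partialPhi_of_axis hs] at this
  simp [metric, rSqDphi, rDr] at this
  exact this

/-! ### Closed lightlike paths from the axis -/

/-- Let i and j be the first and the last segment that leave r ≤ 1. The end segments have ℓ = 0 and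
stay inside, so i ≥ 1 and j ≤ n - 2. The light cone of the axis gives τ ≥ τ_* at the first point of
segment i with r = 1 and τ ≤ -τ_* at the last such point of segment j, so `six_le_of_steps` yields j
- i + 1 ≥ 6. -/
theorem eight_le_of_closed {n : ℕ} (hn : 0 < n) {A : ℕ → Event} {γ : ℕ → ℝ → Event} {l : ℕ → ℝ}
    (hpath : IsLightlikePath n A γ l) (h0 : uu (A 0) = 0) (h1 : uu (A n) = 0)
    (hτ : tau (A 0) = tau (A n)) (hτ0 : tau (A 0) = 0) : 8 ≤ n := by
  have hm := fun i (hi : i < n) => (hpath i hi).isFutureNullGeodesic.radialMotion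
  have hp := fun i (hi : i < n) => (hpath i hi).pos
  have hA := fun i (hi : i < n) => (hpath i hi).initial
  have hA' := fun i (hi : i < n) => (hpath i hi).terminal
  set out : ℕ → Prop := fun i => ∃ t ∈ Set.Icc 0 (l i), 1 < uu (γ i t) with hout
  have first_inside : ∀ t, uu (γ 0 t) ≤ 1 := by
    have := hm 0 hn
    rw [(hpath 0 hn).isFutureNullGeodesic.L2_eq_zero (by rw [hA 0 hn]; exact h0)] at this
    exact this.le_one_of_axial
  have last_inside : ∀ t, uu (γ (n - 1) t) ≤ 1 := by
    have hlt : n - 1 < n := by omega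
    have := hm (n - 1) hlt
    rw [(hpath _ hlt).isFutureNullGeodesic.L2_eq_zero (s := l (n - 1)) (by
      rw [hA' _ hlt, Nat.sub_add_cancel hn]; exact h1)] at this
    exact this.le_one_of_axial
  have fwd : ∀ k ≤ n, (∀ i < k, ¬ out i) →
      uu (A k) ≤ 1 ∧ coneTime (Real.sqrt (uu (A k))) ≤ tau (A k) := by
    intro k
    induction k with
    | zero => intro _ _; rw [h0, Real.sqrt_zero, coneTime_zero, hτ0]; norm_num
    | succ k ih =>
      intro hk hin
      obtain ⟨-, h3⟩ := ih (by omega) fun i hi => hin i (by omega)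
      have hkn : k < n := by omega
      have hins : ∀ t ∈ Set.Icc 0 (l k), uu (γ k t) ≤ 1 := fun t ht => by
        by_contra hcon
        push Not at hcon
        exact hin k (by omega) ⟨t, ht, hcon⟩
      have hc := (hm k hkn).cone (hp k hkn).le fun t ht => hins t ⟨ht.1.le, ht.2.le⟩
      have hl := hins (l k) ⟨(hp k hkn).le, le_rfl⟩
      simp only [hA k hkn, hA' k hkn] at hc hl
      exact ⟨hl, by linarith⟩
  have bwd : ∀ k ≤ n, (∀ i, n - k ≤ i → i < n → ¬ out i) →
      uu (A (n - k)) ≤ 1 ∧ coneTime (Real.sqrt (uu (A (n - k)))) ≤ -tau (A (n - k)) := by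
    intro k
    induction k with
    | zero =>
      intro _ _
      rw [Nat.sub_zero, h1, Real.sqrt_zero, coneTime_zero, ← hτ, hτ0]; norm_num
    | succ k ih =>
      intro hk hin
      obtain ⟨-, h3⟩ := ih (by omega) fun i hi => hin i (by omega)
      have hkn : n - (k + 1) < n := by omega
      have e : n - (k + 1) + 1 = n - k := by omega
      have hins : ∀ t ∈ Set.Icc 0 (l (n - (k + 1))), uu (γ (n - (k + 1)) t) ≤ 1 := fun t ht => by
        by_contra hcon
        push Not at hcon
        exact hin _ le_rfl hkn ⟨t, ht, hcon⟩
      have hc := (hm _ hkn).cone_reverse (hp _ hkn).le fun t ht => hins t ⟨ht.1.le, ht.2.le⟩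
      have hl := hins 0 ⟨le_rfl, (hp _ hkn).le⟩
      simp only [hA _ hkn, hA' _ hkn, e] at hc hl
      exact ⟨hl, by linarith⟩
  by_cases hex : ∃ i < n, out i
  · classical
    obtain ⟨i, ⟨hin, hiout⟩, himin⟩ : ∃ i, (i < n ∧ out i) ∧ ∀ k < i, ¬ out k := by
      refine ⟨Nat.find hex, Nat.find_spec hex, fun k hk hk' => Nat.find_min hex hk
        ⟨hk.trans (Nat.find_spec hex).1, hk'⟩⟩
    obtain ⟨j, ⟨hjn, hjout⟩, hjmax⟩ : ∃ j, (j < n ∧ out j) ∧ ∀ k, j < k → k < n → ¬ out k := by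
      have hspec := Nat.findGreatest_spec (P := fun j => j < n ∧ out j) hin.le ⟨hin, hiout⟩
      exact ⟨_, hspec, fun k hk hkn hk' =>
        Nat.findGreatest_is_greatest (P := fun j => j < n ∧ out j) hk hkn.le ⟨hkn, hk'⟩⟩
    have hij : i ≤ j := by
      by_contra hcon
      push Not at hcon
      exact himin j hcon hjout
    have hi1 : 1 ≤ i := by
      rcases Nat.eq_zero_or_pos i with rfl | h
      · obtain ⟨t, -, ht⟩ := hiout
        exact absurd (first_inside t) (not_le.2 ht)
      · exact h
    have hj1 : j + 2 ≤ n := by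
      by_contra hcon
      obtain rfl : j = n - 1 := by omega
      obtain ⟨t, -, ht⟩ := hjout
      exact absurd (last_inside t) (not_le.2 ht)
    obtain ⟨f1, f2⟩ := fwd i hin.le himin
    obtain ⟨b1, b2⟩ := bwd (n - (j + 1)) (by omega) fun k hk hkn => hjmax k (by omega) hkn
    rw [show n - (n - (j + 1)) = j + 1 by omega] at b1 b2
    obtain ⟨t₁, t₁', a1, a2, a3, a4, -, a6⟩ := (hm i hin).exists_first_last_outside
      (by obtain ⟨t, ht, h⟩ := hiout; exact ⟨t, ht, h.le⟩)
    obtain ⟨t₂', t₂, c1, c2, c3, -, c5, c6⟩ := (hm j hjn).exists_first_last_outside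
      (by obtain ⟨t, ht, h⟩ := hjout; exact ⟨t, ht, h.le⟩)
    simp only [hA i hin, max_eq_right f1] at a4
    simp only [hA' j hjn, max_eq_right b1] at c5
    have hP : tauStar ≤ tau (γ i t₁) := by
      have := (hm i hin).cone a1 fun t ht => by
        by_contra hcon
        push Not at hcon
        have := (a6 t ⟨ht.1.le, by linarith [ht.2]⟩ hcon.le).1
        linarith [ht.2]
      simp only [a4, hA i hin, Real.sqrt_one, coneTime_one] at this
      linarith
    have hQ : tau (γ j t₂) ≤ -tauStar := by
      have := (hm j hjn).cone_reverse c3 fun t ht => by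
        by_contra hcon
        push Not at hcon
        have := (c6 t ⟨by linarith [ht.1], ht.2.le⟩ hcon.le).2
        linarith [ht.1]
      simp only [c5, hA' j hjn, Real.sqrt_one, coneTime_one] at this
      linarith
    have key : 6 ≤ j - i + 1 := by
      refine six_le_of_steps
        -- Segments i and j are truncated at the horizon; for i = j only the single step from `t₁`
        -- to `t₂` remains.
        (B := fun k => if k = 0 then γ i t₁ else if k ≤ j - i then A (i + k) else γ j t₂)
        (fun k hk => ?_) ?_ ?_ ?_ ?_
      · have hgi := (hpath i hin).isFutureNullGeodesic
        have hgj := (hpath j hjn).isFutureNullGeodesic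
        have s1 : Step (γ i t₁) (A (i + 1)) := by
          rw [← hA' i hin]; exact hgi.step (a2.trans a3)
        have s2 : Step (A j) (γ j t₂) := by
          rw [← hA j hjn]; exact hgj.step (c1.trans c2)
        rcases Nat.eq_zero_or_pos k with rfl | hk0
        · rcases hij.eq_or_lt with rfl | hlt
          · obtain ⟨t, ht, h⟩ := hiout
            have := a6 t ht h.le
            have := c6 t ht h.le
            have s3 : Step (γ i t₁) (γ i t₂) := hgi.step (by linarith)
            simpa using s3
          · have : 1 ≤ j - i := by omega
            simpa [this] using s1
        · have h3 : k ≤ j - i := by omega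
          rcases h3.eq_or_lt with h4 | h4
          · have e1 : ¬ (k + 1 ≤ j - i) := by omega
            have e2 : i + k = j := by omega
            simpa [hk0.ne', h3, e1, e2] using s2
          · have e1 : k + 1 ≤ j - i := h4
            have := (hpath (i + k) (by omega)).step
            simpa [hk0.ne', h3, e1, add_assoc] using this
      · simp [a4]
      · simpa using hP
      · simp [c5]
      · simpa using hQ
    omega
  · push Not at hex
    exfalso
    have hb := (bwd (n - 1) (by omega) fun i _ hi => hex i hi).2
    rw [show n - (n - 1) = 1 by omega] at hb
    have hm0 := hm 0 hn
    rw [(hpath 0 hn).isFutureNullGeodesic.L2_eq_zero (s := 0) (by rw [hA 0 hn]; exact h0)] at hm0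
    have := hm0.τ_lt_of_axial (by rw [hA 0 hn]; exact h0) (hp 0 hn)
    simp only [hA 0 hn, hA' 0 hn, zero_add] at this
    have := coneTime_nonneg (Real.sqrt_nonneg (uu (A 1)))
    linarith

/-! ### Construction of null geodesics from their first integrals -/

/-- Where r r' ≠ 0, the vectors γ', ∂/∂φ, ∂/∂τ, ∂/∂ζ form a basis; this is the expansion of w in it.
Hence the four conservation laws imply the full geodesic equation there, and continuity extends it
across turning points. -/
theorem geodExpr_span (p v a w : Event) :
    rDr p v * geodExpr p v a w = rDr p w * geodExpr p v a v
      + (v 1 * w 2 - v 2 * w 1) * geodExpr p v a (partialPhi p)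
      + (rDr p v * w 0 - rDr p w * v 0) * geodExpr p v a partialTau
      + (rDr p v * w 3 - rDr p w * v 3) * geodExpr p v a partialZeta := by
  have hne : 1 + (p 1 ^ 2 + p 2 ^ 2) ≠ 0 := by positivity
  simp [geodExpr, metricDeriv_eq, rSqDphi, rDr, metric, partialPhi, partialTau, partialZeta]
  field_simp
  ring

theorem continuous_geodExpr {γ v a : ℝ → Event} (hγ : Continuous γ) (hv : Continuous v)
    (ha : Continuous a) (w : Event) : Continuous fun s => geodExpr (γ s) (v s) (a s) w := by
  have h1 : ∀ i, Continuous fun s => γ s i := fun i => (continuous_apply i).comp hγ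
  have h2 : ∀ i, Continuous fun s => v s i := fun i => (continuous_apply i).comp hv
  have h3 : ∀ i, Continuous fun s => a s i := fun i => (continuous_apply i).comp ha
  have hne : ∀ s, 1 + (γ s 1 ^ 2 + γ s 2 ^ 2) ≠ 0 := fun s => by positivity
  have hne' : ∀ s, (1 + (γ s 1 ^ 2 + γ s 2 ^ 2)) ^ 2 ≠ 0 := fun s => by positivity
  simp only [geodExpr, metricDeriv_eq, rSqDphi, rDr, metric]
  fun_prop (disch := assumption)

/-- A curve with constant `L₁`, `L₂`, `L₃` and null velocity is a geodesic, unless it is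
tangent to a cylinder `r = const` on an interval. -/
theorem isGeodesic_of_integrals {γ : ℝ → Event} (hC : ContDiff ℝ 2 γ) {c₁ c₂ c₃ : ℝ}
    (h1 : ∀ s, metric (γ s) (deriv γ s) partialTau = c₁)
    (h2 : ∀ s, metric (γ s) (deriv γ s) (partialPhi (γ s)) = c₂)
    (h3 : ∀ s, metric (γ s) (deriv γ s) partialZeta = c₃)
    (h4 : ∀ s, metric (γ s) (deriv γ s) (deriv γ s) = 0)
    (hd : Dense {s | rDr (γ s) (deriv γ s) ≠ 0}) : IsGeodesic γ := by
  refine ⟨hC, fun s w => ?_⟩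
  have hC1 : ContDiff ℝ 1 (deriv γ) := ((contDiff_succ_iff_deriv (n := 1)).1 hC).2.2
  have hC0 : Continuous (deriv (deriv γ)) := hC1.continuous_deriv (by norm_num)
  have hcont := continuous_geodExpr hC.continuous hC1.continuous hC0 w
  suffices (fun s => geodExpr (γ s) (deriv γ s) (deriv (deriv γ) s) w) = fun _ => 0 from
    congrFun this s
  refine Continuous.ext_on hd hcont continuous_const fun s hs => ?_
  obtain ⟨d1, d2⟩ := hasDerivAt_of_contDiff_two hC s
  have e1 : geodExpr (γ s) (deriv γ s) (deriv (deriv γ) s) partialTau = 0 := by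
    have := hasDerivAt_metric d1 d2 (hasDerivAt_const s partialTau)
    simp only [h1] at this
    rw [geodExpr_tau, ← this.unique (hasDerivAt_const s c₁)]
    simp [metric, rSqDphi, rDr]
  have e3 : geodExpr (γ s) (deriv γ s) (deriv (deriv γ) s) partialZeta = 0 := by
    have := hasDerivAt_metric d1 d2 (hasDerivAt_const s partialZeta)
    simp only [h3] at this
    rw [geodExpr_zeta, ← this.unique (hasDerivAt_const s c₃)]
    simp [metric, rSqDphi, rDr]
  have e2 : geodExpr (γ s) (deriv γ s) (deriv (deriv γ) s) (partialPhi (γ s)) = 0 := by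
    have := hasDerivAt_metric d1 d2 (hasDerivAt_partialPhi d1)
    simp only [h2] at this
    rw [geodExpr_phi, this.unique (hasDerivAt_const s c₂)]
  have e4 : geodExpr (γ s) (deriv γ s) (deriv (deriv γ) s) (deriv γ s) = 0 := by
    have := hasDerivAt_metric d1 d2 d2
    simp only [h4] at this
    have := this.unique (hasDerivAt_const s (0 : ℝ))
    have e := geodExpr_velocity (γ s) (deriv γ s) (deriv (deriv γ) s)
    rw [metric_comm (γ s) (deriv γ s)] at this
    linarith
  have := geodExpr_span (γ s) (deriv γ s) (deriv (deriv γ) s) w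
  rw [e1, e2, e3, e4] at this
  simp only [mul_zero, add_zero] at this
  exact (mul_eq_zero.1 this).resolve_left hs

theorem dense_ne_zero_of_simple_zeros {f f' : ℝ → ℝ} (hf : ∀ s, HasDerivAt f (f' s) s)
    (h : ∀ s, f s = 0 → f' s ≠ 0) : Dense {s | f s ≠ 0} := by
  intro s
  by_cases hs : f s = 0
  · have := ((hf s).eventually_ne (c := 0) (h s hs)).frequently
    exact mem_closure_iff_frequently.2 (this.filter_mono nhdsWithin_le_nhds)
  · exact subset_closure hs

theorem contDiff_two_of_hasDerivAt {F f : ℝ → ℝ} (hF : ∀ s, HasDerivAt F (f s) s)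
    (hf : ContDiff ℝ 1 f) : ContDiff ℝ 2 F := by
  have : deriv F = f := funext fun s => (hF s).deriv
  exact (contDiff_succ_iff_deriv (n := 1)).2
    ⟨fun s => (hF s).differentiableAt, by simp, by rwa [this]⟩

theorem exists_antiderivative {f : ℝ → ℝ} (hf : ContDiff ℝ 1 f) (c : ℝ) :
    ∃ F : ℝ → ℝ, F 0 = c ∧ (∀ s, HasDerivAt F (f s) s) ∧ ContDiff ℝ 2 F := by
  have h : ∀ s, HasDerivAt (fun s => c + ∫ t in (0 : ℝ)..s, f t) (f s) s := fun s =>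
    (hf.continuous.integral_hasStrictDerivAt 0 s).hasDerivAt.const_add c
  exact ⟨_, by simp, h, contDiff_two_of_hasDerivAt h hf⟩

/-- The event with cylindrical coordinates `(τ, r, φ, ζ)`. -/
noncomputable def polar (t r φ z : ℝ) : Event := ![t, r * Real.cos φ, r * Real.sin φ, z]

theorem uu_polar (t r φ z : ℝ) : uu (polar t r φ z) = r ^ 2 := by
  have := Real.sin_sq_add_cos_sq φ
  simp only [uu, polar, Matrix.cons_val]
  linear_combination r ^ 2 * this

theorem tau_polar (t r φ z : ℝ) : tau (polar t r φ z) = t := rfl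

theorem exists_polar (P : Event) : ∃ φ, P = polar (tau P) (radius P) φ (zeta P) := by
  refine ⟨Complex.arg ⟨P 1, P 2⟩, ?_⟩
  have hn : ‖(⟨P 1, P 2⟩ : ℂ)‖ = radius P := by
    rw [Complex.norm_def, Complex.normSq_mk, radius]; congr 1; ring
  have h1 := Complex.norm_mul_cos_arg ⟨P 1, P 2⟩
  have h2 := Complex.norm_mul_sin_arg ⟨P 1, P 2⟩
  rw [hn] at h1 h2
  funext i
  fin_cases i
  · rfl
  · exact h1.symm
  · exact h2.symm
  · rfl

/-- A planar null geodesic with `L₁ = 1`, `L₂ = ℓ` in cylindrical coordinates; `r` may change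
its sign. -/
structure PolarOrbit (ℓ : ℝ) (r φ t r' φ' t' : ℝ → ℝ) : Prop where
  contDiff_r : ContDiff ℝ 2 r
  contDiff_φ : ContDiff ℝ 2 φ
  contDiff_t : ContDiff ℝ 2 t
  deriv_r : ∀ s, HasDerivAt r (r' s) s
  deriv_φ : ∀ s, HasDerivAt φ (φ' s) s
  deriv_t : ∀ s, HasDerivAt t (t' s) s
  energy : ∀ s, t' s + Real.sqrt 2 * (r s ^ 2 * φ' s) = 1
  momentum : ∀ s, Real.sqrt 2 * r s ^ 2 * t' s - (1 - r s ^ 2) * (r s ^ 2 * φ' s) = ℓ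
  null : ∀ s, -t' s ^ 2 - 2 * Real.sqrt 2 * r s ^ 2 * φ' s * t' s
    + r s ^ 2 * (1 - r s ^ 2) * φ' s ^ 2 + (1 + r s ^ 2)⁻¹ * r' s ^ 2 = 0
  dense : Dense {s | r s * r' s ≠ 0}

namespace PolarOrbit

variable {ℓ : ℝ} {r φ t r' φ' t' : ℝ → ℝ}

/-- The isometry (τ, φ) ↦ (-τ, c - φ) reverses time orientation; reversing the parameter restores
it. Both constants L₁ and L₂ survive. -/
theorem reflect (h : PolarOrbit ℓ r φ t r' φ' t') (a c : ℝ) :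
    PolarOrbit ℓ (fun s => r (a - s)) (fun s => c - φ (a - s)) (fun s => -t (a - s))
      (fun s => -r' (a - s)) (fun s => φ' (a - s)) (fun s => t' (a - s)) where
  contDiff_r := h.contDiff_r.comp (contDiff_const.sub contDiff_id)
  contDiff_φ := contDiff_const.sub (h.contDiff_φ.comp (contDiff_const.sub contDiff_id))
  contDiff_t := (h.contDiff_t.comp (contDiff_const.sub contDiff_id)).neg
  deriv_r s := (h.deriv_r (a - s)).comp_const_sub a s
  deriv_φ s := (((h.deriv_φ (a - s)).comp_const_sub a s).const_sub c).congr_deriv (neg_neg _)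
  deriv_t s := ((h.deriv_t (a - s)).comp_const_sub a s).neg.congr_deriv (neg_neg _)
  energy s := h.energy _
  momentum s := h.momentum _
  null s := by rw [neg_sq (r' _)]; exact h.null _
  dense := by
    have := h.dense.preimage (Homeomorph.subLeft a).isOpenMap
    convert this using 1
    ext s
    simp

theorem translate (h : PolarOrbit ℓ r φ t r' φ' t') (c d : ℝ) :
    PolarOrbit ℓ r (fun s => φ s + c) (fun s => t s + d) r' φ' t' where
  contDiff_r := h.contDiff_r
  contDiff_φ := h.contDiff_φ.add contDiff_const
  contDiff_t := h.contDiff_t.add contDiff_const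
  deriv_r := h.deriv_r
  deriv_φ s := (h.deriv_φ s).add_const c
  deriv_t s := (h.deriv_t s).add_const d
  energy := h.energy
  momentum := h.momentum
  null := h.null
  dense := h.dense

theorem hasDerivAt_polar (h : PolarOrbit ℓ r φ t r' φ' t') (z s : ℝ) :
    HasDerivAt (fun s => polar (t s) (r s) (φ s) z)
      ![t' s, Real.cos (φ s) * r' s - r s * Real.sin (φ s) * φ' s,
        Real.sin (φ s) * r' s + r s * Real.cos (φ s) * φ' s, 0] s := by
  refine hasDerivAt_pi.2 fun i => ?_
  fin_cases i
  · exact h.deriv_t s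
  · exact ((h.deriv_r s).mul (h.deriv_φ s).cos).congr_deriv (by simp; ring)
  · exact ((h.deriv_r s).mul (h.deriv_φ s).sin).congr_deriv (by simp; ring)
  · exact hasDerivAt_const s z

theorem isFutureNullGeodesic (h : PolarOrbit ℓ r φ t r' φ' t') (z : ℝ) :
    IsFutureNullGeodesic (fun s => polar (t s) (r s) (φ s) z) ∧
    L1 (fun s => polar (t s) (r s) (φ s) z) = 1 ∧ L2 (fun s => polar (t s) (r s) (φ s) z) = ℓ ∧
    L3 (fun s => polar (t s) (r s) (φ s) z) = 0 := by
  set γ : ℝ → Event := fun s => polar (t s) (r s) (φ s) z with hγ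
  have hd : ∀ s, deriv γ s = _ := fun s => (h.hasDerivAt_polar z s).deriv
  have hJ : ∀ s, rSqDphi (γ s) (deriv γ s) = r s ^ 2 * φ' s := by
    intro s
    have := Real.sin_sq_add_cos_sq (φ s)
    rw [hd]
    simp only [rSqDphi, hγ, polar, Matrix.cons_val]
    linear_combination r s ^ 2 * φ' s * this
  have hR : ∀ s, rDr (γ s) (deriv γ s) = r s * r' s := by
    intro s
    have := Real.sin_sq_add_cos_sq (φ s)
    rw [hd]
    simp only [rDr, hγ, polar, Matrix.cons_val]
    linear_combination r s * r' s * this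
  have hu : ∀ s, uu (γ s) = r s ^ 2 := fun s => uu_polar _ _ _ _
  have ht : ∀ s, deriv γ s 0 = t' s := fun s => by rw [hd]; rfl
  have hz : ∀ s, deriv γ s 3 = 0 := fun s => by rw [hd]; rfl
  have h1 : ∀ s, metric (γ s) (deriv γ s) partialTau = -1 := fun s => by
    rw [metric_tau_eq, hJ, ht, h.energy]
  have h2 : ∀ s, metric (γ s) (deriv γ s) (partialPhi (γ s)) = -ℓ := fun s => by
    rw [metric_phi_eq, hJ, ht, hu, h.momentum]
  have h3 : ∀ s, metric (γ s) (deriv γ s) partialZeta = 0 := fun s => by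
    rw [metric_zeta_eq, hz]
  have h4 : ∀ s, metric (γ s) (deriv γ s) (deriv γ s) = 0 := fun s => by
    rw [hd]
    refine (metric_cylindrical _ _ _ _ _ _ _ _).trans ?_
    linear_combination h.null s
  have hC : ContDiff ℝ 2 γ := by
    refine contDiff_pi.2 fun i => ?_
    fin_cases i
    · exact h.contDiff_t
    · exact h.contDiff_r.mul h.contDiff_φ.cos
    · exact h.contDiff_r.mul h.contDiff_φ.sin
    · exact contDiff_const
  refine ⟨⟨isGeodesic_of_integrals hC h1 h2 h3 h4 ?_, h4, fun s => ?_⟩, ?_, ?_, ?_⟩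
  · simp only [hR]; exact h.dense
  · rw [metric_comm, h1]; norm_num
  · rw [L1, h1, neg_neg]
  · rw [L2, h2, neg_neg]
  · rw [L3, h3]

end PolarOrbit

theorem exists_axial_orbit : ∃ φ φ' : ℝ → ℝ,
    PolarOrbit 0 Real.sin φ axialTau Real.cos φ' (fun s => Real.cos s ^ 2 / (1 + Real.sin s ^ 2)) := by
  have hne : ∀ s : ℝ, 1 + Real.sin s ^ 2 ≠ 0 := fun s => by positivity
  have c1 : ContDiff ℝ 1 fun s : ℝ => Real.sqrt 2 / (1 + Real.sin s ^ 2) :=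
    contDiff_const.div (contDiff_const.add (Real.contDiff_sin.pow 2)) hne
  have c2 : ContDiff ℝ 1 fun s : ℝ => Real.cos s ^ 2 / (1 + Real.sin s ^ 2) :=
    (Real.contDiff_cos.pow 2).div (contDiff_const.add (Real.contDiff_sin.pow 2)) hne
  obtain ⟨φ, -, hφ, hφC⟩ := exists_antiderivative c1 0
  have h2 := sqrt_two_sq
  refine ⟨φ, _, Real.contDiff_sin, hφC, contDiff_two_of_hasDerivAt hasDerivAt_axialTau c2,
    Real.hasDerivAt_sin, hφ, hasDerivAt_axialTau, fun s => ?_, fun s => ?_, fun s => ?_, ?_⟩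
  · have := hne s
    have hc := Real.cos_sq' s
    rw [hc]
    field_simp
    linear_combination Real.sin s ^ 2 * h2
  · have := hne s
    have hc := Real.cos_sq' s
    rw [hc]
    field_simp
    ring
  · have := hne s
    have hc := Real.cos_sq' s
    rw [hc]
    field_simp
    linear_combination -(Real.sin s ^ 2 * (1 - Real.sin s ^ 2)) * h2
  · refine dense_ne_zero_of_simple_zeros
      (fun s => (Real.hasDerivAt_sin s).mul (Real.hasDerivAt_cos s)) fun s hs => ?_
    have := Real.sin_sq_add_cos_sq s
    rcases mul_eq_zero.1 hs with h | h
    · rw [h] at this ⊢; nlinarith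
    · rw [h] at this ⊢; nlinarith

theorem axis_eq_polar (φ z : ℝ) : (![0, 0, 0, z] : Event) = polar 0 0 φ z := by
  simp [polar]

theorem lightlikeConnected_one {γ : ℝ → Event} {l : ℝ} {P Q : Event} (h : IsNullSegment γ l P Q) :
    LightlikeConnected 1 P Q := by
  refine ⟨fun i => if i = 0 then P else Q, fun _ => γ, fun _ => l, fun i hi => ?_, by simp, by simp⟩
  obtain rfl : i = 0 := by omega
  simpa using h

theorem axis_to_horizon (ψ z : ℝ) :
    LightlikeConnected 1 ![0, 0, 0, z] (polar tauStar 1 ψ z) := by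
  obtain ⟨φ, φ', h⟩ := exists_axial_orbit
  have h' := h.translate (ψ - φ (Real.pi / 2)) 0
  refine lightlikeConnected_one
    ⟨(h'.isFutureNullGeodesic z).1, (by positivity : 0 < Real.pi / 2), ?_, ?_⟩
  · simp only [axialTau_zero, Real.sin_zero, add_zero]
    rw [axis_eq_polar]
  · simp [axialTau_pi_div_two]

theorem horizon_to_axis (ψ z : ℝ) :
    LightlikeConnected 1 (polar (-tauStar) 1 ψ z) ![0, 0, 0, z] := by
  obtain ⟨φ, φ', h⟩ := exists_axial_orbit
  have h' := h.reflect (Real.pi / 2) (ψ + φ (Real.pi / 2))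
  refine lightlikeConnected_one
    ⟨(h'.isFutureNullGeodesic z).1, (by positivity : 0 < Real.pi / 2), ?_, ?_⟩
  · simp [axialTau_pi_div_two]
  · simp only [axialTau_zero, Real.sin_zero, sub_self, neg_zero]
    rw [axis_eq_polar]

/-- The planar null geodesic with `L₁ = 1`, `L₂ = ℓ > 0`, initial values `r² = u₀` and
`r r' = q` of the radial motion. -/
theorem exists_orbit {ℓ u₀ q : ℝ} (hℓ : 0 < ℓ) (hu₀ : 0 < u₀)
    (hq : q ^ 2 = u₀ * (1 - u₀) + 2 * Real.sqrt 2 * u₀ * ℓ - ℓ ^ 2)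
    (hne : 2 * u₀ < 1 + 2 * Real.sqrt 2 * ℓ) (τ₀ φ₀ : ℝ) :
    ∃ r φ t r' φ' t' : ℝ → ℝ, PolarOrbit ℓ r φ t r' φ' t' ∧ (∀ s, 0 < r s) ∧
      r 0 = Real.sqrt u₀ ∧ φ 0 = φ₀ ∧ t 0 = τ₀ ∧ r 0 * r' 0 = q ∧
      r (Real.pi / 2) = Real.sqrt (1 + 2 * Real.sqrt 2 * ℓ - u₀) := by
  have h2 := sqrt_two_sq
  set a := (1 + 2 * Real.sqrt 2 * ℓ) / 2 with ha
  have ha0 : 0 < a := by positivity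
  set u : ℝ → ℝ := fun s => a + (u₀ - a) * Real.cos (2 * s) + q * Real.sin (2 * s) with hu
  set R : ℝ → ℝ := fun s => (a - u₀) * Real.sin (2 * s) + q * Real.cos (2 * s) with hR
  have hcs : ∀ s : ℝ, Real.sin (2 * s) ^ 2 + Real.cos (2 * s) ^ 2 = 1 := fun s =>
    Real.sin_sq_add_cos_sq _
  have hQ : ∀ s, R s ^ 2 = u s * (1 - u s) + 2 * Real.sqrt 2 * u s * ℓ - ℓ ^ 2 := by
    intro s
    have e : R s ^ 2 = ((a - u₀) ^ 2 + q ^ 2) - (u s - a) ^ 2 := by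
      simp only [hR, hu]
      linear_combination ((a - u₀) ^ 2 + q ^ 2) * hcs s
    rw [e, hq, ha]
    ring
  have hupos : ∀ s, 0 < u s := by
    intro s
    have h := hQ s
    -- As ℓ ≠ 0 the right side is positive, so u cannot reach 0.
    have e : u s * (2 * a - u s) = R s ^ 2 + ℓ ^ 2 := by rw [h, ha]; ring
    by_contra hcon
    push Not at hcon
    nlinarith [sq_nonneg (R s), mul_pos hℓ hℓ, mul_nonneg (neg_nonneg.2 hcon)
      (by linarith : 0 ≤ 2 * a - u s)]
  have hlin : ∀ s : ℝ, HasDerivAt (fun s : ℝ => 2 * s) 2 s := fun s => by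
    simpa using (hasDerivAt_id s).const_mul (2 : ℝ)
  have hud : ∀ s, HasDerivAt u (2 * R s) s := fun s => by
    refine ((((hlin s).cos.const_mul (u₀ - a)).const_add a).add
      ((hlin s).sin.const_mul q)).congr_deriv ?_
    simp only [hR]; ring
  have hRd : ∀ s, HasDerivAt R (2 * (a - u s)) s := fun s => by
    refine (((hlin s).sin.const_mul (a - u₀)).add ((hlin s).cos.const_mul q)).congr_deriv ?_
    simp only [hu]; ring
  have huC : ContDiff ℝ 2 u := by fun_prop
  have hRC : ContDiff ℝ 1 R := by fun_prop
  set r : ℝ → ℝ := fun s => Real.sqrt (u s) with hr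
  have hrpos : ∀ s, 0 < r s := fun s => Real.sqrt_pos.2 (hupos s)
  have hrsq : ∀ s, r s ^ 2 = u s := fun s => Real.sq_sqrt (hupos s).le
  have hrd : ∀ s, HasDerivAt r (R s / r s) s := fun s => by
    refine ((hud s).sqrt (hupos s).ne').congr_deriv ?_
    rw [mul_div_mul_left _ _ two_ne_zero]
  have hrC : ContDiff ℝ 2 r := huC.sqrt fun s => (hupos s).ne'
  have huC1 : ContDiff ℝ 1 u := huC.of_le (by norm_num)
  have hU : ∀ s, 1 + u s ≠ 0 := fun s => by have := hupos s; positivity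
  have c1 : ContDiff ℝ 1 fun s => (Real.sqrt 2 * u s - ℓ) / (u s * (1 + u s)) :=
    ((contDiff_const.mul huC1).sub contDiff_const).div (huC1.mul (contDiff_const.add huC1))
      fun s => mul_ne_zero (hupos s).ne' (hU s)
  have c2 : ContDiff ℝ 1 fun s => ((1 - u s) + Real.sqrt 2 * ℓ) / (1 + u s) :=
    ((contDiff_const.sub huC1).add contDiff_const).div (contDiff_const.add huC1) hU
  obtain ⟨φ, hφ0, hφ, hφC⟩ := exists_antiderivative c1 φ₀
  obtain ⟨t, ht0, ht, htC⟩ := exists_antiderivative c2 τ₀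
  have hr0 : r 0 = Real.sqrt u₀ := by simp [hr, hu]
  have hrR : ∀ s, r s * (R s / r s) = R s := fun s => mul_div_cancel₀ _ (hrpos s).ne'
  refine ⟨r, φ, t, _, _, _, ⟨hrC, hφC, htC, hrd, hφ, ht, fun s => ?_, fun s => ?_, fun s => ?_, ?_⟩,
    hrpos, hr0, hφ0, ht0, ?_, ?_⟩
  · have := (hupos s).ne'
    have := hU s
    rw [hrsq]
    field_simp
    linear_combination u s * h2
  · have := (hupos s).ne'
    have := hU s
    rw [hrsq]
    field_simp
    linear_combination u s * ℓ * h2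
  · have := (hupos s).ne'
    have := hU s
    rw [div_pow (R s), hrsq, hQ]
    field_simp
    ring_nf
    simp only [h2, show Real.sqrt 2 ^ 3 = 2 * Real.sqrt 2 by rw [pow_succ, h2]]
    ring
  · simp only [hrR]
    -- A double zero of R would make u constant, that is u₀ = a and q = 0; `hne` says u₀ < a.
    refine dense_ne_zero_of_simple_zeros hRd fun s hs h0 => ?_
    have e1 : u s - a = 0 := by linarith
    have e2 : (a - u₀) ^ 2 + q ^ 2 = R s ^ 2 + (u s - a) ^ 2 := by
      simp only [hR, hu]
      linear_combination -((a - u₀) ^ 2 + q ^ 2) * hcs s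
    rw [hs, e1] at e2
    have : 0 < a - u₀ := by rw [ha]; linarith
    nlinarith [sq_nonneg q, mul_pos this this]
  · rw [hrR]; simp [hR]
  · simp only [hr, hu]
    rw [show 2 * (Real.pi / 2) = Real.pi by ring, Real.cos_pi, Real.sin_pi, ha]
    congr 1
    ring

/-! ### SE-segments and their reflections -/

/-- For u > 1 the radicand is a concave quadratic in κ with smaller root κ₁(u); for u = 1 it is
linear. -/
theorem kappa1_le {u κ : ℝ} (hu : 1 ≤ u) (hκ : 0 ≤ envRadicand u κ) : kappa1 u ≤ κ := by
  have h2 := sqrt_two_sq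
  have hs0 : 0 < Real.sqrt 2 := by positivity
  rw [kappa1]
  unfold envRadicand at hκ
  split_ifs with h
  · subst h
    rw [div_le_iff₀ (by positivity)]
    linarith
  · have h1 : 0 < u - 1 := sub_pos.2 (lt_of_le_of_ne hu (Ne.symm h))
    have hu0 : 0 < u := by linarith
    rw [div_le_iff₀ (by positivity), sub_le_iff_le_add', ← sub_le_iff_le_add]
    by_contra hcon
    push Not at hcon
    have h3 := Real.lt_sq_of_sqrt_lt (show Real.sqrt (u ^ 2 + u) <
      Real.sqrt 2 * u - κ * (u * (u - 1)) by linarith)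
    have h4 := mul_nonneg (mul_pos hu0 h1).le hκ
    have h5 : (Real.sqrt 2 * u - κ * (u * (u - 1))) ^ 2 = u ^ 2 + u
        - u * (u - 1) * (u * (1 - u) * κ ^ 2 + 2 * Real.sqrt 2 * u * κ - 1) := by
      linear_combination u ^ 2 * h2
    linarith

theorem se_kappa_mem {u₀ u₁ κ : ℝ} (h0 : 1 ≤ u₀) (h1 : u₀ + 1 ≤ u₁)
    (hD : (u₀ + u₁ - 1) ^ 2 ≤ 8 * (u₀ * u₁)) (hκ : κ = 2 * Real.sqrt 2 / (u₀ + u₁ - 1)) :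
    κ ∈ Set.Icc (kappa1 u₀) (kappaMin u₀) := by
  have h2 := sqrt_two_sq
  have hS : 0 < u₀ + u₁ - 1 := by linarith
  refine ⟨kappa1_le h0 ?_, ?_⟩
  · rw [envRadicand, hκ, div_pow, mul_pow, h2]
    have : u₀ * (1 - u₀) * (2 ^ 2 * 2 / (u₀ + u₁ - 1) ^ 2)
        + 2 * Real.sqrt 2 * u₀ * (2 * Real.sqrt 2 / (u₀ + u₁ - 1)) - 1
        = (8 * (u₀ * u₁) - (u₀ + u₁ - 1) ^ 2) / (u₀ + u₁ - 1) ^ 2 := by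
      field_simp
      linear_combination 4 * u₀ * (u₀ + u₁ - 1) * h2
    rw [this]
    exact div_nonneg (by linarith) (by positivity)
  · rw [hκ, kappaMin, div_le_div_iff₀ hS (by linarith)]
    nlinarith [Real.sqrt_nonneg 2]

theorem arctan_eq_of_half_turn {ℓ q Y θ : ℝ} (hℓ : 0 < ℓ) (hY : 0 < Y) (hθ0 : 0 < θ)
    (hθ : θ ≤ Real.pi / 2) (hs : Y * Real.sin θ = Real.sqrt 2 + ℓ) (hc : Y * Real.cos θ = q) :
    Real.arctan (q / ℓ / (Real.sqrt 2 * (1 / ℓ) + 1)) = Real.pi / 2 - θ := by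
  have hs0 : 0 < Real.sqrt 2 := by positivity
  have hsin : 0 < Real.sin θ :=
    Real.sin_pos_of_pos_of_lt_pi hθ0 (by linarith [Real.pi_pos])
  have : q / ℓ / (Real.sqrt 2 * (1 / ℓ) + 1) = Real.tan (Real.pi / 2 - θ) := by
    rw [Real.tan_eq_sin_div_cos, Real.sin_pi_div_two_sub, Real.cos_pi_div_two_sub,
      show q / ℓ / (Real.sqrt 2 * (1 / ℓ) + 1) = q / (Real.sqrt 2 + ℓ) by field_simp, ← hs, ← hc,
      mul_div_mul_left _ _ hY.ne']
  rw [this, Real.arctan_tan (by linarith) (by linarith)]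

/-- Half a radial period takes u₀ to 1 + 2√2 ℓ - u₀, which fixes ℓ = 1/κ. The condition `h1` amounts
to κ ≤ `kappaMin u₀`, and `hD` makes the radicand nonnegative, so that r r' = q ≥ 0 exists at the
start. At Δ = π/2 the oscillator relation becomes sin θ = (u₀ + u₁ + 3)/(2√2 Y), and q ≥ 0 puts θ in
[0, π/2]: the segment realizes `gain` exactly. The free angle ψ lets reflected segments be joined.
-/
theorem exists_seSegment {u₀ u₁ : ℝ} (h0 : 1 ≤ u₀) (h1 : u₀ + 1 ≤ u₁)
    (hD : (u₀ + u₁ - 1) ^ 2 ≤ 8 * (u₀ * u₁)) (τ₀ φ₀ z : ℝ) :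
    ∃ (γ : ℝ → Event) (φ₁ : ℝ),
      IsNullSegment γ (Real.pi / 2) (polar τ₀ (Real.sqrt u₀) φ₀ z)
        (polar (τ₀ + gain u₀ u₁) (Real.sqrt u₁) φ₁ z) ∧
      IsSESegment γ (Real.pi / 2) ∧
      ∀ ψ : ℝ, ∃ (γ' : ℝ → Event) (ψ' : ℝ),
        IsNullSegment γ' (Real.pi / 2) (polar (-(τ₀ + gain u₀ u₁)) (Real.sqrt u₁) ψ z)
          (polar (-τ₀) (Real.sqrt u₀) ψ' z) ∧
        IsReflection γ' (Real.pi / 2) γ (Real.pi / 2) := by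
  have h2 := sqrt_two_sq
  have hs0 : 0 < Real.sqrt 2 := by positivity
  have hpi : 0 < Real.pi / 2 := by positivity
  have hS : 0 < u₀ + u₁ - 1 := by linarith
  obtain ⟨ℓ, hℓ⟩ : ∃ ℓ, ℓ = (u₀ + u₁ - 1) / (2 * Real.sqrt 2) := ⟨_, rfl⟩
  have hℓ0 : 0 < ℓ := by rw [hℓ]; positivity
  have hℓ2 : 2 * Real.sqrt 2 * ℓ = u₀ + u₁ - 1 := by rw [hℓ]; field_simp
  have hκ : 1 / ℓ = 2 * Real.sqrt 2 / (u₀ + u₁ - 1) := by rw [hℓ, one_div_div]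
  obtain ⟨q, hq⟩ : ∃ q, q = Real.sqrt (u₀ * u₁ - (u₀ + u₁ - 1) ^ 2 / 8) := ⟨_, rfl⟩
  have hq0 : 0 ≤ q := by rw [hq]; positivity
  have hq2 : q ^ 2 = u₀ * u₁ - (u₀ + u₁ - 1) ^ 2 / 8 := by
    rw [hq]; exact Real.sq_sqrt (by linarith)
  have hqℓ : q ^ 2 = u₀ * (1 - u₀) + 2 * Real.sqrt 2 * u₀ * ℓ - ℓ ^ 2 := by
    have : ℓ ^ 2 = (u₀ + u₁ - 1) ^ 2 / 8 := by
      rw [hℓ, div_pow, mul_pow, h2]; ring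
    rw [hq2, this]
    linear_combination -u₀ * hℓ2
  obtain ⟨r, φ, t, r', φ', t', horb, hrpos, hr0, hφ0, ht0, hrr', hr1⟩ :=
    exists_orbit hℓ0 (by linarith) hqℓ (by linarith) τ₀ φ₀
  rw [hℓ2, show 1 + (u₀ + u₁ - 1) - u₀ = u₁ by ring] at hr1
  obtain ⟨hg, hL1, hL2, hL3⟩ := horb.isFutureNullGeodesic z
  have hrad : ∀ s, radius (polar (t s) (r s) (φ s) z) = r s := fun s => by
    have := radius_sq (polar (t s) (r s) (φ s) z)
    rw [uu_polar] at this
    exact (pow_left_inj₀ (Real.sqrt_nonneg _) (hrpos s).le two_ne_zero).1 this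
  have hsq0 : Real.sqrt u₀ ^ 2 = u₀ := Real.sq_sqrt (by linarith)
  have hsq1 : Real.sqrt u₁ ^ 2 = u₁ := Real.sq_sqrt (by linarith)
  -- the angle swept by the oscillator
  have hm := hg.radialMotion
  rw [hL1, hL2, hL3] at hm
  simp only [uu_polar, tau_polar] at hm
  set Y := Real.sqrt ((1 + u₀) * (1 + u₁)) with hY
  have hY0 : 0 < Y := Real.sqrt_pos.2 (mul_pos (by linarith) (by linarith))
  have hrDr : rDr (polar (t 0) (r 0) (φ 0) z) (deriv (fun s => polar (t s) (r s) (φ s) z) 0) = q := by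
    rw [(horb.hasDerivAt_polar z 0).deriv, ← hrr']
    have := Real.sin_sq_add_cos_sq (φ 0)
    simp only [rDr, polar, Matrix.cons_val]
    linear_combination r 0 * r' 0 * this
  obtain ⟨hosc, hosc2⟩ := hm.oscillator one_pos (by norm_num) (Real.pi / 2)
  have hrel := hm.oscillator_relation one_pos (by norm_num) (Real.pi / 2)
  have hθ0 := hm.angle_pos hpi
  have hθπ := hm.angle_le_pi one_pos (by norm_num) hpi (by linarith)
  have hθ : RadialMotion.angle 1 t (Real.pi / 2) =
      (t (Real.pi / 2) - τ₀ + Real.pi / 2) / Real.sqrt 2 := by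
    rw [RadialMotion.angle, ht0, one_mul]
  set θ := RadialMotion.angle 1 t (Real.pi / 2) with hθd
  simp only [one_mul, Real.cos_pi_div_two, Real.sin_pi_div_two, mul_zero, zero_mul, zero_add,
    hrDr, hr1, hsq1, mul_one, div_one] at hosc hosc2 hrel
  rw [hr0, hsq0] at hosc hosc2 hrel
  rw [← Real.sqrt_mul (by linarith), ← hY] at hosc hosc2
  rw [← hY, h2] at hrel
  have hcos : 0 ≤ Real.cos θ := by
    by_contra hcon
    push Not at hcon
    have := mul_neg_of_pos_of_neg hY0 hcon
    linarith
  have hθ2 : θ ≤ Real.pi / 2 := by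
    by_contra hcon
    push Not at hcon
    exact absurd hcos (not_le.2 (Real.cos_neg_of_pi_div_two_lt_of_lt hcon (by linarith)))
  have hsin : Real.sin θ = (u₀ + u₁ + 3) / (2 * Real.sqrt 2 * Y) := by
    rw [eq_div_iff (by positivity)]
    linarith
  have harc : θ = Real.arcsin ((u₀ + u₁ + 3) / (2 * Real.sqrt 2 * Y)) := by
    rw [← hsin, Real.arcsin_sin (by linarith) hθ2]
  have htθ : t (Real.pi / 2) = τ₀ - Real.pi / 2 + Real.sqrt 2 * θ := by
    rw [hθ]; field_simp; ring
  have htau : t (Real.pi / 2) = τ₀ + gain u₀ u₁ := by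
    rw [gain, ← hY, ← harc, htθ]; ring
  have hκγ : kappa (fun s => polar (t s) (r s) (φ s) z) = 1 / ℓ := by rw [kappa, hL1, hL2]
  have hlamγ : lam (fun s => polar (t s) (r s) (φ s) z) = 0 := by rw [lam, hL3, zero_div]
  have henvTau : t (Real.pi / 2) = envTau u₀ τ₀ (1 / ℓ) := by
    have hr : Real.sqrt (envRadicand u₀ (1 / ℓ)) = q / ℓ := by
      rw [show envRadicand u₀ (1 / ℓ) = (q / ℓ) ^ 2 by
        rw [div_pow, hqℓ, envRadicand]; field_simp, Real.sqrt_sq (by positivity)]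
    rw [envTau, hr, arctan_eq_of_half_turn hℓ0 hY0 hθ0 hθ2 hosc2 hosc, htθ]
    ring
  refine ⟨_, φ (Real.pi / 2), ⟨hg, hpi, by simp only [hr0, hφ0, ht0],
    by simp only [hr1, htau]⟩, ⟨hg, hpi, ?_, ?_, hlamγ, ?_, ?_, ?_⟩, fun ψ => ?_⟩
  · simp only [hrad]
    rw [hr0]
    exact Real.one_le_sqrt.2 h0
  · rw [hL2]; exact hℓ0
  · rw [hκγ]
    simp only [hrad]
    rw [hr0, hsq0]
    exact se_kappa_mem h0 h1 hD hκ
  · simp only [hrad]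
    rw [(horb.deriv_r 0).deriv]
    by_contra hcon
    push Not at hcon
    have := mul_neg_of_pos_of_neg (hrpos 0) hcon
    linarith
  · simp only [hrad, tau_polar]
    rw [hr0, hsq0, hr1, hsq1, ht0]
    refine ⟨1 / ℓ, se_kappa_mem h0 h1 hD hκ, ?_⟩
    rw [← henvTau, envU, hκ]
    congr 1
    field_simp
    ring
  · have hrefl := horb.reflect (Real.pi / 2) (ψ + φ (Real.pi / 2))
    obtain ⟨kg, kL1, kL2, kL3⟩ := hrefl.isFutureNullGeodesic z
    have hrad' : ∀ s, radius (polar (-t (Real.pi / 2 - s)) (r (Real.pi / 2 - s))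
        (ψ + φ (Real.pi / 2) - φ (Real.pi / 2 - s)) z) = r (Real.pi / 2 - s) := fun s => by
      have := radius_sq (polar (-t (Real.pi / 2 - s)) (r (Real.pi / 2 - s))
        (ψ + φ (Real.pi / 2) - φ (Real.pi / 2 - s)) z)
      rw [uu_polar] at this
      exact (pow_left_inj₀ (Real.sqrt_nonneg _) (hrpos _).le two_ne_zero).1 this
    refine ⟨_, ψ + φ (Real.pi / 2) - φ 0, ⟨kg, hpi, ?_, ?_⟩, ⟨rfl, ?_, ?_, ?_, ?_, ?_, ?_⟩⟩
    · simp only [sub_zero, hr1, htau, add_sub_cancel_right]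
    · simp only [sub_self, hr0, ht0]
    · rw [kL2]; exact hℓ0
    · rw [lam, kL3, zero_div]
    · rw [kappa, kL1, kL2, hκγ]
    · intro s _; rw [hrad', hrad]
    · intro s _; rfl
    · intro s _; rfl

/-! ### Choice of the radii -/

theorem cos_quartic_lower {d : ℝ} (h0 : 0 ≤ d) (h1 : d ≤ 1) :
    1 - d ^ 2 / 2 + d ^ 4 / 32 ≤ Real.cos d := by
  have h := Real.one_sub_sq_div_two_le_cos (x := d / 2)
  have e : Real.cos d = 2 * Real.cos (d / 2) ^ 2 - 1 := by
    rw [← Real.cos_two_mul]; congr 1; ring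
  have h2 : (1 - (d / 2) ^ 2 / 2) ^ 2 ≤ Real.cos (d / 2) ^ 2 :=
    pow_le_pow_left₀ (by nlinarith) h 2
  rw [e]
  linarith

theorem gain_le_of_sqrt_le {a b d y : ℝ} (h0 : 0 ≤ d) (h1 : d ≤ 1) (hy : 0 < y)
    (hy2 : y ^ 2 ≤ (1 + a) * (1 + b))
    (h : a + b + 3 ≤ (1 - d ^ 2 / 2 + d ^ 4 / 32) * (2 * 1.41421 * y)) :
    gain a b ≤ -(Real.pi / 2) + Real.sqrt 2 * (Real.pi / 2 - d) := by
  have hs := sqrt_two_bounds.1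
  have hY := Real.le_sqrt_of_sq_le hy2
  have hY0 : 0 < Real.sqrt ((1 + a) * (1 + b)) := hy.trans_le hY
  have hc : 0 ≤ 1 - d ^ 2 / 2 + d ^ 4 / 32 := by
    have h3 : d ^ 2 ≤ 1 := by nlinarith
    have h4 : 0 ≤ d ^ 4 := by positivity
    linarith
  have hpi := Real.pi_gt_three
  have : Real.arcsin ((a + b + 3) / (2 * Real.sqrt 2 * Real.sqrt ((1 + a) * (1 + b))))
      ≤ Real.pi / 2 - d := by
    rcases h0.eq_or_lt with rfl | h0'
    · simpa using Real.arcsin_le_pi_div_two _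
    refine (Real.arcsin_le_iff_le_sin' ⟨by linarith, by linarith⟩).2 ?_
    rw [Real.sin_pi_div_two_sub]
    refine le_trans ?_ (cos_quartic_lower h0 h1)
    rw [div_le_iff₀ (by positivity)]
    refine h.trans (mul_le_mul_of_nonneg_left ?_ hc)
    exact mul_le_mul (by linarith) hY hy.le (by positivity)
  rw [gain]
  linarith [mul_le_mul_of_nonneg_left this (Real.sqrt_nonneg 2)]

/-- The values 3.4 and 5.8 make three steps suffice with room to spare: at u = 6.8, the least value
with u₀ + 1 ≤ u₁, the sum is about -0.03. At u = 22 it is positive, by `two_gain_lower` and the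
estimate arcsin ≥ π/3 for the last step. The intermediate value theorem gives u. -/
theorem exists_last_radius : ∃ u : ℝ, 6.8 ≤ u ∧ u ≤ 22 ∧
    tauStar + gain 1 3.4 + gain 3.4 5.8 + gain 5.8 u = 0 := by
  obtain ⟨hl, hu⟩ := sqrt_two_bounds
  have h2 := sqrt_two_sq
  have hpi := Real.pi_gt_d4
  have hpi' := Real.pi_lt_d4
  have hcont : ContinuousOn (fun u => tauStar + gain 1 3.4 + gain 3.4 5.8 + gain 5.8 u)
      (Set.Icc 6.8 22) := by
    have hne : ∀ u ∈ Set.Icc (6.8 : ℝ) 22,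
        2 * Real.sqrt 2 * Real.sqrt ((1 + 5.8) * (1 + u)) ≠ 0 := by
      intro u hu
      have : 0 < 1 + u := by linarith [hu.1]
      positivity
    unfold gain
    refine continuousOn_const.add (continuousOn_const.add (continuousOn_const.mul
      (Real.continuous_arcsin.comp_continuousOn (ContinuousOn.div ?_ ?_ hne))))
    · fun_prop
    · fun_prop
  have h0 : tauStar + gain 1 3.4 + gain 3.4 5.8 + gain 5.8 6.8 ≤ 0 := by
    have g1 := gain_le_of_sqrt_le (a := 1) (b := 3.4) (d := 0.489) (y := 2.9664)
      (by norm_num) (by norm_num) (by norm_num) (by norm_num) (by norm_num)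
    have g2 := gain_le_of_sqrt_le (a := 3.4) (b := 5.8) (d := 0.659) (y := 5.4699)
      (by norm_num) (by norm_num) (by norm_num) (by norm_num) (by norm_num)
    have g3 := gain_le_of_sqrt_le (a := 5.8) (b := 6.8) (d := 0.7075) (y := 7.2828)
      (by norm_num) (by norm_num) (by norm_num) (by norm_num) (by norm_num)
    rw [tauStar]
    nlinarith
  have h1 : 0 ≤ tauStar + gain 1 3.4 + gain 3.4 5.8 + gain 5.8 22 := by
    have g1 := two_gain_lower (a := 3.4) (b := 5.8) (by norm_num) (by norm_num)
    have hY : Real.sqrt ((1 + 5.8) * (1 + 22)) ≤ 12.51 :=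
      Real.sqrt_le_iff.2 ⟨by norm_num, by norm_num⟩
    have hY0 : 0 < Real.sqrt ((1 + 5.8) * (1 + 22)) := Real.sqrt_pos.2 (by norm_num)
    have g2 : Real.pi / 3 ≤ Real.arcsin ((5.8 + 22 + 3) /
        (2 * Real.sqrt 2 * Real.sqrt ((1 + 5.8) * (1 + 22)))) := by
      refine (Real.le_arcsin_iff_sin_le' ⟨by linarith, by linarith⟩).2 ?_
      have h3 : Real.sqrt 3 ≤ 1.7321 := Real.sqrt_le_iff.2 ⟨by norm_num, by norm_num⟩
      rw [Real.sin_pi_div_three, le_div_iff₀ (by positivity)]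
      have : Real.sqrt 2 * Real.sqrt ((1 + 5.8) * (1 + 22)) ≤ 1.41422 * 12.51 :=
        mul_le_mul hu.le hY hY0.le (by norm_num)
      nlinarith [Real.sqrt_nonneg 3]
    have := mul_le_mul_of_nonneg_left g2 (Real.sqrt_nonneg 2)
    have e : gain 5.8 22 = -(Real.pi / 2) + Real.sqrt 2 * Real.arcsin ((5.8 + 22 + 3) /
        (2 * Real.sqrt 2 * Real.sqrt ((1 + 5.8) * (1 + 22)))) := rfl
    rw [maxDrop] at g1
    nlinarith
  obtain ⟨u, hu, e⟩ := intermediate_value_Icc (by norm_num) hcont ⟨h0, h1⟩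
  exact ⟨u, hu.1, hu.2, e⟩

end Godel

/-! ### The optimal path -/

theorem proposition6 (A₀ : Godel.Event) (hr : Godel.radius A₀ = 1)
    (hτ : Godel.tau A₀ = Godel.tauStar) :
    ∃ (m : ℕ) (A : ℕ → Godel.Event) (γ : ℕ → ℝ → Godel.Event) (ℓ : ℕ → ℝ),
      -- a lightlike path with `2 m` segments from `A₀` to a point with `(r, τ) = (1, -τ_*)`
      Godel.IsLightlikePath (2 * m) A γ ℓ ∧ A 0 = A₀ ∧
      Godel.radius (A (2 * m)) = 1 ∧ Godel.tau (A (2 * m)) = -Godel.tauStar ∧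
      -- it is optimal among all lightlike paths between points with these values of `(r, τ)`
      (∀ (n : ℕ) (P Q : Godel.Event),
        Godel.radius P = 1 → Godel.tau P = Godel.tauStar →
        Godel.radius Q = 1 → Godel.tau Q = -Godel.tauStar →
        Godel.LightlikeConnected n P Q → 2 * m ≤ n) ∧
      -- with one more segment at either end it becomes an optimal closed lightlike path
      -- from the point `(τ, r, ζ) = (0, 0, ζ(A₀))` of the axis to itself
      Godel.LightlikeConnected 1 ![0, 0, 0, Godel.zeta A₀] A₀ ∧
      Godel.LightlikeConnected 1 (A (2 * m)) ![0, 0, 0, Godel.zeta A₀] ∧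
      (∀ n : ℕ, 0 < n →
        Godel.LightlikeConnected n ![0, 0, 0, Godel.zeta A₀] ![0, 0, 0, Godel.zeta A₀] →
        2 * m + 2 ≤ n) ∧
      -- its first `m` segments reach `τ = 0`, with the least possible number of segments
      Godel.tau (A m) = 0 ∧
      (∀ (n : ℕ) (P Q : Godel.Event),
        Godel.radius P = 1 → Godel.tau P = Godel.tauStar → Godel.tau Q = 0 →
        Godel.LightlikeConnected n P Q → m ≤ n) ∧
      -- the first `m` segments are SE-segments
      (∀ i < m, Godel.IsSESegment (γ i) (ℓ i)) ∧
      -- the last `m` segments are the reflections of the first `m` segments, in reverse order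
      (∀ i < m, Godel.IsReflection (γ (2 * m - 1 - i)) (ℓ (2 * m - 1 - i)) (γ i) (ℓ i)) := by
  open Godel in
  obtain ⟨φ₀, hA₀⟩ := exists_polar A₀
  rw [hr, hτ] at hA₀
  generalize zeta A₀ = z at hA₀ ⊢
  obtain ⟨u₃, hu, hu', hsum⟩ := exists_last_radius
  obtain ⟨γ₁, φ₁, p₁, s₁, r₁⟩ := exists_seSegment (u₀ := 1) (u₁ := 3.4) (by norm_num) (by norm_num)
    (by norm_num) tauStar φ₀ z
  obtain ⟨γ₂, φ₂, p₂, s₂, r₂⟩ := exists_seSegment (u₀ := 3.4) (u₁ := 5.8) (by norm_num)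
    (by norm_num) (by norm_num) (tauStar + gain 1 3.4) φ₁ z
  obtain ⟨γ₃, φ₃, p₃, s₃, r₃⟩ := exists_seSegment (u₀ := 5.8) (u₁ := u₃) (by norm_num)
    (by norm_num at hu ⊢; linarith) (by nlinarith) (tauStar + gain 1 3.4 + gain 3.4 5.8) φ₂ z
  -- The way back is built from the outermost point inwards; each reflected segment starts at the
  -- angle where the previous one ended.
  obtain ⟨γ₄, ψ₂, p₄, q₄⟩ := r₃ φ₃
  obtain ⟨γ₅, ψ₁, p₅, q₅⟩ := r₂ ψ₂
  obtain ⟨γ₆, ψ₀, p₆, q₆⟩ := r₁ ψ₁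
  rw [hsum] at p₃ p₄
  rw [neg_zero] at p₄
  rw [Real.sqrt_one] at p₁ p₆
  have hrad : radius (polar (-tauStar) 1 ψ₀ z) = 1 := by
    rw [radius_eq_one_iff, uu_polar, one_pow]
  refine ⟨3, fun k => match k with
    | 0 => polar tauStar 1 φ₀ z
    | 1 => polar (tauStar + gain 1 3.4) (Real.sqrt 3.4) φ₁ z
    | 2 => polar (tauStar + gain 1 3.4 + gain 3.4 5.8) (Real.sqrt 5.8) φ₂ z
    | 3 => polar 0 (Real.sqrt u₃) φ₃ z
    | 4 => polar (-(tauStar + gain 1 3.4 + gain 3.4 5.8)) (Real.sqrt 5.8) ψ₂ z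
    | 5 => polar (-(tauStar + gain 1 3.4)) (Real.sqrt 3.4) ψ₁ z
    | _ => polar (-tauStar) 1 ψ₀ z,
    fun k => match k with
    | 0 => γ₁
    | 1 => γ₂
    | 2 => γ₃
    | 3 => γ₄
    | 4 => γ₅
    | _ => γ₆, fun _ => Real.pi / 2, ?_, hA₀.symm, hrad, rfl, ?_, ?_, horizon_to_axis ψ₀ z, ?_, rfl,
    ?_, ?_, ?_⟩
  · intro i hi
    interval_cases i
    exacts [p₁, p₂, p₃, p₄, p₅, p₆]
  · rintro n P Q h1 h2 h3 h4 ⟨B, δ, l, hB, rfl, rfl⟩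
    exact six_le_of_steps (fun k hk => (hB k hk).step) (radius_eq_one_iff.1 h1).le h2.ge
      (radius_eq_one_iff.1 h3).le h4.le
  · rw [hA₀]; exact axis_to_horizon φ₀ z
  · rintro n hn ⟨B, δ, l, hB, h0, h1⟩
    have hu0 : uu ![0, 0, 0, z] = 0 := by simp [uu]
    exact eight_le_of_closed hn hB (h0 ▸ hu0) (h1 ▸ hu0) (by rw [h0, h1]) (by rw [h0]; rfl)
  · rintro n P Q h1 h2 h3 ⟨B, δ, l, hB, rfl, rfl⟩
    exact three_le_of_steps (fun k hk => (hB k hk).step) (radius_eq_one_iff.1 h1).le h2.ge h3.le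
  · intro i hi
    interval_cases i
    exacts [s₁, s₂, s₃]
  · intro i hi
    interval_cases i
    exacts [q₆, q₅, q₄]
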